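/- Let $k$ be a field; all algebras are associative $k$-algebras, not necessarily unital, modules are left modules on $k$-vector spaces, and $\otimes=\otimes_k$. **Modules.** Let $D$ be an algebra. A $D$-module $V$ is *unital* if $V=DV$ (the span of all $xv$); it is *simple* if $DV\neq 0$ and $0,V$ are its only submodules; it is *absolutely simple* if $K\otimes V$ is a simple $K\otimes D$-module for every field extension $k\subseteq K$; it is *absolutely semisimple* if it is a (possibly empty or infinite) direct sum of absolutely simple modules. The algebra $D$ is *absolutely semisimple* if every unital $D$-module is absolutely semisimple. **Morita equivalence.** A Morita context consists of vector spaces $A_{ij}$ ($i,j\in\{1,2\}$) with bilinear products $A_{ij}\times A_{jl}\to A_{il}$ that are associative whenever composable. It is *strict* if the four multiplication maps $A_{ij}\otimes_{A_{jj}}A_{ji}\to A_{ii}$ are bijective. An algebra $D$ is *firm* if multiplication $D\otimes_D D\to D$ is bijective; two firm algebras $D,E$ are *Morita equivalent* if there is a strict Morita context with $A_{11}\cong D$ and $A_{22}\cong E$ as algebras. For a set $I$, $k_I=\bigoplus_{i\in I}k$ is the algebra of finitely supported functions $I\to k$ with pointwise product. **Coactions.** Let $(H,\Delta)$ be a Hopf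 algebra over $k$ with invariant functionals, i.e. there are non-zero linear $\varphi,\psi:H\to k$ with $(\mathrm{id}\otimes\varphi)\Delta(h)=\varphi(h)1$ and $(\psi\otimes\mathrm{id})\Delta(h)=\psi(h)1$ for all $h\in H$. Let $(A,\alpha)$ be an $H$-comodule algebra: $\alpha:A\to A\otimes H$, $\alpha(a)=a_{(0)}\otimes a_{(1)}$, is an algebra homomorphism making $A$ a right $H$-comodule. Assume that $A$ has $H$-coinvariant local units: for every finite subset $\{a_1,\dots,a_n\}\subseteq A$ there is $e\in A$ with $\alpha(e)=e\otimes 1$ and $ea_i=a_i=a_ie$ for all $i$. An *$H$-equivariant $A$-module* is an $A$-module $V$ with a right $H$-comodule structure $\delta:V\to V\otimes H$ such that $\delta(av)=\alpha(a)\delta(v)$; it is *unital* if $V=AV$. It is *equivariantly simple* if $AV\ne0$ and $0,V$ are its only submodules that are also subcomodules; *equivariantly absolutely simple* if $K\otimes V$ is equivariantly simple as a $K\otimes H$-equivariant $K\otimes A$-module for every field extension $k\subseteq K$; *equivariantly absolutely semisimple* if it is a direct sum of equivariantly absolutely simple equivariant submodules. $(A,\alpha)$ is *$H$-equivariantly absolutely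 semisimple* if every unital $H$-equivariant $A$-module is equivariantly absolutely semisimple. **Smash product.** Let $\hat H=\{\varphi(h\,\cdot\,)\mid h\in H\}\subseteq H^*$, with the convolution product $(\omega*\chi)(h)=(\omega\otimes\chi)\Delta(h)$. The smash product $A\#\hat H$ is the vector space $A\otimes\hat H$ with the product $$(a\otimes\omega)(b\otimes\chi)=ab_{(0)}\otimes\bigl(\omega(b_{(1)}\,\cdot\,)*\chi\bigr).$$ **Theorem.** The following are equivalent: 1. $(A,\alpha)$ is $H$-equivariantly absolutely semisimple; 2. the algebra $A\#\hat H$ is absolutely semisimple; 3. $A\#\hat H$ is Morita equivalent to $k_I$ for some set $I$. -/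

import Mathlib

open scoped TensorProduct

universe u v w

namespace HopfCoaction

noncomputable section

/-! ## Modules over algebras that need not have a unit

A `k`-algebra is a `NonUnitalRing D` with `Module k D`, `IsScalarTower k D D` and
`SMulCommClass k D D`. A left `D`-module on a vector space `V` is a bilinear action
`act : D →ₗ[k] V →ₗ[k] V` satisfying `IsModuleAction act`. Simplicity and the formation of
restrictions and scalar extensions only involve the bilinear map. -/

section Modules

/-- The action `act` is associative, so that it makes `V` a left `D`-module. -/
def IsModuleAction {k : Type*} [Field k] {D : Type*} [NonUnitalRing D] [Module k D]
    {V : Type*} [AddCommGroup V] [Module k V] (act : D →ₗ[k] V →ₗ[k] V) : Prop :=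
  ∀ (x y : D) (m : V), act (x * y) m = act x (act y m)

variable {k : Type*} [Field k] {D : Type*} [AddCommGroup D] [Module k D]
  {V : Type*} [AddCommGroup V] [Module k V]

/-- The module is unital: `V = DV`, where `DV` consists of all sums `∑ x_i v_i`. -/
def IsUnitalAction (act : D →ₗ[k] V →ₗ[k] V) : Prop :=
  Submodule.span k {m : V | ∃ (x : D) (m' : V), act x m' = m} = ⊤

/-- `W` is a `D`-submodule of `V`. -/
def IsInvariant (act : D →ₗ[k] V →ₗ[k] V) (W : Submodule k V) : Prop :=
  ∀ (x : D), ∀ m ∈ W, act x m ∈ W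

/-- The module `V` is simple: `DV ≠ 0`, and `0` and `V` are its only submodules. -/
def IsSimpleAction (act : D →ₗ[k] V →ₗ[k] V) : Prop :=
  (∃ (x : D) (m : V), act x m ≠ 0) ∧
    ∀ W : Submodule k V, IsInvariant act W → W = ⊥ ∨ W = ⊤

/-- The `K ⊗ D`-module `K ⊗ V`, with `(c ⊗ x) (d ⊗ v) = cd ⊗ xv`. -/
def baseChangeAction (K : Type*) [Field K] [Algebra k K] (act : D →ₗ[k] V →ₗ[k] V) :
    (K ⊗[k] D) →ₗ[K] (K ⊗[k] V) →ₗ[K] (K ⊗[k] V) :=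
  LinearMap.liftBaseChange K (LinearMap.baseChangeHom k K V V ∘ₗ act)

theorem baseChangeAction_tmul (K : Type*) [Field K] [Algebra k K] (act : D →ₗ[k] V →ₗ[k] V)
    (c d : K) (x : D) (m : V) :
    baseChangeAction K act (c ⊗ₜ x) (d ⊗ₜ m) = (c * d) ⊗ₜ act x m := by
  simp [baseChangeAction, TensorProduct.smul_tmul']

/-- The restriction of the action to a submodule. -/
def restrictAction (act : D →ₗ[k] V →ₗ[k] V) (W : Submodule k V) (hW : IsInvariant act W) :
    D →ₗ[k] W →ₗ[k] W :=
  LinearMap.mk₂ k (fun x m => ⟨act x m, hW x m m.2⟩)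
    (fun _ _ _ => by ext; simp) (fun _ _ _ => by ext; simp)
    (fun _ _ _ => by ext; simp) (fun _ _ _ => by ext; simp)

end Modules

section AbsolutelySemisimple

variable {k : Type u} [Field k] {D : Type*} [AddCommGroup D] [Module k D]
  {V : Type v} [AddCommGroup V] [Module k V]

/-- `V` is absolutely simple: `K ⊗ V` is a simple `K ⊗ D`-module for all field extensions `K`. -/
def IsAbsolutelySimpleAction (act : D →ₗ[k] V →ₗ[k] V) : Prop :=
  ∀ (K : Type (max u v)) [Field K] [Algebra k K], IsSimpleAction (baseChangeAction K act)

open Classical in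
/-- `V` is a (possibly empty, possibly infinite) direct sum of absolutely simple submodules. -/
def IsAbsolutelySemisimpleAction (act : D →ₗ[k] V →ₗ[k] V) : Prop :=
  ∃ (ι : Type v) (W : ι → Submodule k V) (hW : ∀ i, IsInvariant act (W i)),
    DirectSum.IsInternal W ∧ ∀ i, IsAbsolutelySimpleAction (restrictAction act (W i) (hW i))

/-- The algebra `D` is absolutely semisimple: every unital `D`-module is absolutely
semisimple (the modules range over the universe of `k` and `D`). -/
def IsAbsolutelySemisimpleAlgebra (k : Type u) [Field k] (D : Type w) [NonUnitalRing D]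
    [Module k D] [IsScalarTower k D D] [SMulCommClass k D D] : Prop :=
  ∀ (V : Type (max u w)) [AddCommGroup V] [Module k V] (act : D →ₗ[k] V →ₗ[k] V),
    IsModuleAction act → IsUnitalAction act → IsAbsolutelySemisimpleAction act

end AbsolutelySemisimple

/-! ## Morita contexts -/

section Morita

/-- A Morita context: vector spaces `A i j` for `i, j ∈ {1, 2}` with associative bilinear
products `A i j × A j l → A i l`. -/
structure MoritaContext (k : Type u) [Field k] where
  /-- the four vector spaces -/
  A : Fin 2 → Fin 2 → Type v
  [addCommGroup : ∀ i j, AddCommGroup (A i j)]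
  [module : ∀ i j, Module k (A i j)]
  /-- the products -/
  mul : ∀ {i j l : Fin 2}, A i j →ₗ[k] A j l →ₗ[k] A i l
  assoc : ∀ {i j l m : Fin 2} (x : A i j) (y : A j l) (z : A l m),
    mul (mul x y) z = mul x (mul y z)

attribute [instance] MoritaContext.addCommGroup MoritaContext.module

namespace MoritaContext

variable {k : Type u} [Field k] (C : MoritaContext.{u, v} k)

/-- The subspace of `A i j ⊗ A j i` by which one divides to get the tensor product
over `A j j`. -/
def balancingRelations (i j : Fin 2) : Submodule k (C.A i j ⊗[k] C.A j i) :=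
  Submodule.span k {t | ∃ (x : C.A i j) (y : C.A j j) (z : C.A j i),
    t = C.mul x y ⊗ₜ[k] z - x ⊗ₜ[k] C.mul y z}

/-- The tensor product of `A i j` and `A j i` over the algebra `A j j`. -/
abbrev BalancedTensor (i j : Fin 2) : Type v :=
  (C.A i j ⊗[k] C.A j i) ⧸ C.balancingRelations i j

/-- The multiplication map from the tensor product of `A i j` and `A j i` over `A j j`
to `A i i`. -/
def balancedMul (i j : Fin 2) : C.BalancedTensor i j →ₗ[k] C.A i i :=
  (C.balancingRelations i j).liftQ (TensorProduct.lift (C.mul (i := i) (j := j) (l := i))) <| by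
    rw [balancingRelations, Submodule.span_le]
    rintro _ ⟨x, y, z, rfl⟩
    simp [C.assoc]

/-- The context is strict: the four maps `A i j ⊗ A j i → A i i`, where the tensor product
is over `A j j`, are isomorphisms. -/
def IsStrict : Prop := ∀ i j : Fin 2, Function.Bijective (C.balancedMul i j)

end MoritaContext

/-- `D` and `E` are Morita equivalent: there is a strict Morita context with `A 0 0 ≅ D` and
`A 1 1 ≅ E` as algebras. Strictness for `i = j` says that `D` and `E` are firm. -/
def IsMoritaEquivalent (k : Type u) [Field k] (D : Type v) [NonUnitalRing D] [Module k D]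
    (E : Type w) [NonUnitalRing E] [Module k E] : Prop :=
  ∃ C : MoritaContext.{u, v} k, C.IsStrict ∧
    (∃ e : D ≃ₗ[k] C.A 0 0, ∀ x y : D, e (x * y) = C.mul (e x) (e y)) ∧
    (∃ f : E ≃ₗ[k] C.A 1 1, ∀ x y : E, f (x * y) = C.mul (f x) (f y))

end Morita

/-! ## Comodules and comodule algebras -/

section Comodules

variable {k : Type*} [Field k] {H : Type*} {V : Type*} [AddCommGroup V] [Module k V]

/-- `δ` makes `V` a right `H`-comodule. -/
structure IsComodule [Ring H] [HopfAlgebra k H] (δ : V →ₗ[k] V ⊗[k] H) : Prop where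
  coassoc : ∀ m : V, TensorProduct.assoc k V H H (δ.rTensor H (δ m)) =
    (Coalgebra.comul (R := k) (A := H)).lTensor V (δ m)
  counit : ∀ m : V,
    TensorProduct.rid k V ((Coalgebra.counit (R := k) (A := H)).lTensor V (δ m)) = m

variable [AddCommGroup H] [Module k H]

/-- `W` is a subcomodule: `δ(W) ⊆ W ⊗ H`. -/
def IsSubcomodule (δ : V →ₗ[k] V ⊗[k] H) (W : Submodule k V) : Prop :=
  ∀ m ∈ W, δ m ∈ LinearMap.range (W.subtype.rTensor H)

/-- The coaction `K ⊗ V → (K ⊗ V) ⊗[K] (K ⊗ H)` obtained by extension of scalars. -/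
def baseChangeCoaction (K : Type*) [Field K] [Algebra k K] (δ : V →ₗ[k] V ⊗[k] H) :
    (K ⊗[k] V) →ₗ[K] (K ⊗[k] V) ⊗[K] (K ⊗[k] H) :=
  (TensorProduct.AlgebraTensorModule.distribBaseChange k K V H).toLinearMap ∘ₗ δ.baseChange K

/-- The restriction of the coaction to a subcomodule `W`: the unique map `W → W ⊗ H` whose
composite with the injection `W ⊗ H → V ⊗ H` is the restriction of `δ`. -/
def restrictCoaction (δ : V →ₗ[k] V ⊗[k] H) (W : Submodule k V) (hW : IsSubcomodule δ W) :
    W →ₗ[k] W ⊗[k] H :=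
  (LinearEquiv.ofInjective (W.subtype.rTensor H)
    (Module.Flat.rTensor_preserves_injective_linearMap _ W.injective_subtype)).symm.toLinearMap ∘ₗ
    (δ ∘ₗ W.subtype).codRestrict (LinearMap.range (W.subtype.rTensor H)) (fun m => hW m m.2)

theorem rTensor_restrictCoaction (δ : V →ₗ[k] V ⊗[k] H) (W : Submodule k V)
    (hW : IsSubcomodule δ W) (m : W) :
    W.subtype.rTensor H (restrictCoaction δ W hW m) = δ m := by
  have h := LinearEquiv.apply_symm_apply (LinearEquiv.ofInjective (W.subtype.rTensor H)
    (Module.Flat.rTensor_preserves_injective_linearMap _ W.injective_subtype))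
    ((δ ∘ₗ W.subtype).codRestrict (LinearMap.range (W.subtype.rTensor H)) (fun m => hW m m.2) m)
  exact congrArg Subtype.val h

end Comodules

/-- A right `H`-comodule algebra structure on the (not necessarily unital) algebra `A`: an algebra
homomorphism `A → A ⊗ H` that is a comodule structure. -/
structure ComoduleAlgebra (k : Type u) [Field k] (H : Type v) [Ring H] [HopfAlgebra k H]
    (A : Type w) [NonUnitalRing A] [Module k A] [IsScalarTower k A A] [SMulCommClass k A A] where
  /-- the coaction -/
  coact : A →ₗ[k] A ⊗[k] H
  map_mul : ∀ a b : A, coact (a * b) = coact a * coact b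
  isComodule : IsComodule coact

section Equivariant

variable {k : Type u} [Field k] {H : Type*} {A : Type*}

/-- `V`, with the action `act` of `A` and the coaction `δ` of `H`, is an `H`-equivariant
`A`-module: it is an `A`-module, an `H`-comodule, and `δ(av) = α(a)δ(v)`. -/
structure IsEquivariantModule [Ring H] [HopfAlgebra k H] [NonUnitalRing A] [Module k A]
    [IsScalarTower k A A] [SMulCommClass k A A] (α : ComoduleAlgebra k H A)
    {V : Type*} [AddCommGroup V] [Module k V]
    (act : A →ₗ[k] V →ₗ[k] V) (δ : V →ₗ[k] V ⊗[k] H) : Prop where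
  isModuleAction : IsModuleAction act
  isComodule : IsComodule δ
  equivariant : ∀ (a : A) (m : V),
    δ (act a m) = TensorProduct.map₂ act (LinearMap.mul k H) (α.coact a) (δ m)

variable [AddCommGroup H] [Module k H] [AddCommGroup A] [Module k A]

/-- `V` is equivariantly simple: `AV ≠ 0`, and `0` and `V` are the only equivariant submodules. -/
def IsEquivariantlySimple {V : Type*} [AddCommGroup V] [Module k V]
    (act : A →ₗ[k] V →ₗ[k] V) (δ : V →ₗ[k] V ⊗[k] H) : Prop :=
  (∃ (a : A) (m : V), act a m ≠ 0) ∧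
    ∀ W : Submodule k V, IsInvariant act W → IsSubcomodule δ W → W = ⊥ ∨ W = ⊤

/-- `V` is equivariantly absolutely simple: `K ⊗ V` is simple as a `K ⊗ H`-equivariant
`K ⊗ A`-module for all field extensions `K`. -/
def IsEquivariantlyAbsolutelySimple {V : Type v} [AddCommGroup V] [Module k V]
    (act : A →ₗ[k] V →ₗ[k] V) (δ : V →ₗ[k] V ⊗[k] H) : Prop :=
  ∀ (K : Type (max u v)) [Field K] [Algebra k K],
    IsEquivariantlySimple (baseChangeAction K act) (baseChangeCoaction K δ)

open Classical in
/-- `V` is a direct sum of equivariant submodules that are equivariantly absolutely simple. -/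
def IsEquivariantlyAbsolutelySemisimple {V : Type v} [AddCommGroup V] [Module k V]
    (act : A →ₗ[k] V →ₗ[k] V) (δ : V →ₗ[k] V ⊗[k] H) : Prop :=
  ∃ (ι : Type v) (W : ι → Submodule k V) (hW : ∀ i, IsInvariant act (W i))
    (hW' : ∀ i, IsSubcomodule δ (W i)),
    DirectSum.IsInternal W ∧ ∀ i, IsEquivariantlyAbsolutelySimple
      (restrictAction act (W i) (hW i)) (restrictCoaction δ (W i) (hW' i))

end Equivariant

namespace ComoduleAlgebra

variable {k : Type u} [Field k] {H : Type v} [Ring H] [HopfAlgebra k H]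
  {A : Type w} [NonUnitalRing A] [Module k A] [IsScalarTower k A A] [SMulCommClass k A A]

/-- `(A, α)` is `H`-equivariantly absolutely semisimple: every unital `H`-equivariant `A`-module
is equivariantly absolutely semisimple (the modules range over the universe of `k`, `H`, `A`). -/
def IsAbsolutelySemisimple (α : ComoduleAlgebra k H A) : Prop :=
  ∀ (V : Type (max u v w)) [AddCommGroup V] [Module k V]
    (act : A →ₗ[k] V →ₗ[k] V) (δ : V →ₗ[k] V ⊗[k] H),
    IsEquivariantModule α act δ → IsUnitalAction act →
      IsEquivariantlyAbsolutelySemisimple act δ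

/-- `A` has `H`-coinvariant local units: every finite subset of `A` has a two-sided unit `e`
with `α(e) = e ⊗ 1`. -/
def HasCoinvariantLocalUnits (α : ComoduleAlgebra k H A) : Prop :=
  ∀ s : Finset A, ∃ e : A, α.coact e = e ⊗ₜ[k] (1 : H) ∧ ∀ a ∈ s, e * a = a ∧ a * e = a

end ComoduleAlgebra

/-! ## Invariant functionals, the dual algebra and the smash product -/

section Dual

variable {k : Type u} [Field k] {H : Type v} [Ring H] [HopfAlgebra k H]

/-- The convolution product `(ω * χ)(h) = (ω ⊗ χ)Δ(h)` on the linear dual of `H`. -/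
def convolution : Module.Dual k H →ₗ[k] Module.Dual k H →ₗ[k] Module.Dual k H :=
  LinearMap.mk₂ k (fun ω χ => LinearMap.mul' k k ∘ₗ TensorProduct.map ω χ ∘ₗ Coalgebra.comul)
    (fun _ _ _ => by simp [TensorProduct.map_add_left, LinearMap.add_comp, LinearMap.comp_add])
    (fun _ _ _ => by simp [TensorProduct.map_smul_left, LinearMap.smul_comp, LinearMap.comp_smul])
    (fun _ _ _ => by simp [TensorProduct.map_add_right, LinearMap.add_comp, LinearMap.comp_add])
    (fun _ _ _ => by simp [TensorProduct.map_smul_right, LinearMap.smul_comp, LinearMap.comp_smul])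

/-- The functional `ω(h-)`. -/
def translate : Module.Dual k H →ₗ[k] H →ₗ[k] Module.Dual k H :=
  LinearMap.mk₂ k (fun ω h => ω ∘ₗ LinearMap.mulLeft k h)
    (fun _ _ _ => by ext; simp) (fun _ _ _ => by ext; simp)
    (fun _ _ _ => by ext; simp [add_mul]) (fun _ _ _ => by ext; simp)

theorem translate_translate (ω : Module.Dual k H) (h g : H) :
    translate (translate ω h) g = translate ω (h * g) := by
  ext x
  simp [translate]

theorem translate_convolution (ω χ : Module.Dual k H) (g : H) :
    translate (convolution ω χ) g = TensorProduct.lift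
      (convolution.compl₁₂ (translate ω) (translate χ)) (Coalgebra.comul (R := k) g) := by
  ext x
  change LinearMap.mul' k k (TensorProduct.map ω χ (Coalgebra.comul (R := k) (g * x))) = _
  rw [Bialgebra.comul_mul]
  generalize Coalgebra.comul (R := k) g = s
  induction s with
  | zero => simp
  | add s s' hs hs' => simp only [map_add, add_mul, hs, hs', LinearMap.add_apply]
  | tmul p q =>
    change _ = LinearMap.mul' k k (TensorProduct.map (translate ω p) (translate χ q) _)
    generalize Coalgebra.comul (R := k) x = t
    induction t with
    | zero => simp
    | add t t' ht ht' => simp only [map_add, mul_add, ht, ht']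
    | tmul y z => simp [translate]

theorem convolution_assoc (ω χ θ : Module.Dual k H) :
    convolution (convolution ω χ) θ = convolution ω (convolution χ θ) := by
  ext x
  have h1 : ∀ t : H ⊗[k] H, LinearMap.mul' k k (TensorProduct.map (convolution ω χ) θ t) =
      LinearMap.mul' k k (TensorProduct.map ω (LinearMap.mul' k k ∘ₗ TensorProduct.map χ θ)
        (TensorProduct.assoc k H H H ((Coalgebra.comul (R := k)).rTensor H t))) := by
    intro t
    induction t with
    | zero => simp
    | add t t' ht ht' => simp only [map_add, ht, ht']
    | tmul p q =>
      simp only [convolution, LinearMap.mk₂_apply, TensorProduct.map_tmul, LinearMap.rTensor_tmul,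
        LinearMap.comp_apply]
      generalize Coalgebra.comul (R := k) p = s
      induction s with
      | zero => simp
      | add s s' hs hs' => simp only [map_add, TensorProduct.add_tmul, hs, hs']
      | tmul y z => simp [mul_assoc]
  have h2 : ∀ t : H ⊗[k] H, LinearMap.mul' k k (TensorProduct.map ω (convolution χ θ) t) =
      LinearMap.mul' k k (TensorProduct.map ω (LinearMap.mul' k k ∘ₗ TensorProduct.map χ θ)
        ((Coalgebra.comul (R := k)).lTensor H t)) := by
    intro t
    induction t with
    | zero => simp
    | add t t' ht ht' => simp only [map_add, ht, ht']
    | tmul p q => simp [convolution]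
  change LinearMap.mul' k k (TensorProduct.map (convolution ω χ) θ _) =
    LinearMap.mul' k k (TensorProduct.map ω (convolution χ θ) _)
  rw [h1, h2, Coalgebra.coassoc_apply]

/-- Invariant functionals on `H`: a non-zero left invariant `φ` and a non-zero right
invariant `ψ`. -/
structure InvariantFunctionals (k : Type u) [Field k] (H : Type v) [Ring H]
    [HopfAlgebra k H] where
  /-- the left invariant functional -/
  φ : Module.Dual k H
  /-- the right invariant functional -/
  ψ : Module.Dual k H
  φ_ne_zero : φ ≠ 0
  ψ_ne_zero : ψ ≠ 0
  left_invariant : ∀ h : H,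
    TensorProduct.rid k H (φ.lTensor H (Coalgebra.comul (R := k) h)) = φ h • (1 : H)
  right_invariant : ∀ h : H,
    TensorProduct.lid k H (ψ.rTensor H (Coalgebra.comul (R := k) h)) = ψ h • (1 : H)

/-- The subspace `Ĥ = {φ(h-) | h ∈ H}` of the linear dual of `H`. -/
def InvariantFunctionals.hat (F : InvariantFunctionals k H) : Submodule k (Module.Dual k H) :=
  LinearMap.range (translate F.φ)

/-- `φ(h x₍₂₎) x₍₁₎ = φ(h₍₂₎ x) S(h₍₁₎)`. -/
theorem InvariantFunctionals.strong_invariance (F : InvariantFunctionals k H) (h x : H) :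
    TensorProduct.rid k H ((translate F.φ h).lTensor H (Coalgebra.comul (R := k) x)) =
      TensorProduct.rid k H (TensorProduct.map (HopfAlgebra.antipode k)
        ((LinearMap.applyₗ x) ∘ₗ translate F.φ) (Coalgebra.comul (R := k) h)) := by
  -- `G h = φ(h x₍₂₎) x₍₁₎`, for which left invariance says `h₍₁₎ G(h₍₂₎) = φ(hx) 1`
  let G : H →ₗ[k] H := (TensorProduct.rid k H).toLinearMap ∘ₗ
    LinearMap.applyₗ (Coalgebra.comul (R := k) x) ∘ₗ LinearMap.lTensorHom H ∘ₗ translate F.φ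
  have hG : ∀ g : H, LinearMap.mul' k H (G.lTensor H (Coalgebra.comul (R := k) g)) =
      F.φ (g * x) • (1 : H) := by
    intro g
    rw [← F.left_invariant (g * x), Bialgebra.comul_mul]
    have hGx : ∀ g, G g = TensorProduct.rid k H
      ((translate F.φ g).lTensor H (Coalgebra.comul (R := k) x)) := fun _ => rfl
    clear_value G
    generalize Coalgebra.comul (R := k) g = s
    generalize Coalgebra.comul (R := k) x = t at hGx
    induction s with
    | zero => simp
    | add s s' hs hs' => simp only [map_add, add_mul, hs, hs']
    | tmul p q =>
      rw [LinearMap.lTensor_tmul, LinearMap.mul'_apply, hGx]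
      clear hGx
      induction t with
      | zero => simp
      | add t t' ht ht' => simp only [map_add, mul_add, ht, ht']
      | tmul y z => simp [translate]
  have h1 : ∀ t : H ⊗[k] H, TensorProduct.rid k H (TensorProduct.map (HopfAlgebra.antipode k)
        ((LinearMap.applyₗ x) ∘ₗ translate F.φ) t) =
      LinearMap.mul' k H (TensorProduct.map (HopfAlgebra.antipode k)
        (LinearMap.mul' k H ∘ₗ G.lTensor H ∘ₗ Coalgebra.comul (R := k)) t) := by
    intro t
    induction t with
    | zero => simp
    | add t t' ht ht' => simp only [map_add, ht, ht']
    | tmul p q => simp [hG, translate]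
  have h2 : ∀ t : H ⊗[k] (H ⊗[k] H), LinearMap.mul' k H (TensorProduct.map
      (HopfAlgebra.antipode k) (LinearMap.mul' k H ∘ₗ G.lTensor H) t) =
      LinearMap.mul' k H (TensorProduct.map (LinearMap.mul' k H ∘ₗ
        (HopfAlgebra.antipode k).rTensor H) G ((TensorProduct.assoc k H H H).symm t)) := by
    intro t
    induction t with
    | zero => simp
    | add t t' ht ht' => simp only [map_add, ht, ht']
    | tmul p q =>
      induction q with
      | zero => simp
      | add t t' ht ht' => simp only [TensorProduct.tmul_add, map_add, ht, ht']
      | tmul q r => simp [mul_assoc]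
  have h3 : ∀ t : H ⊗[k] H, LinearMap.mul' k H (TensorProduct.map (LinearMap.mul' k H ∘ₗ
        (HopfAlgebra.antipode k).rTensor H) G ((Coalgebra.comul (R := k)).rTensor H t)) =
      G (TensorProduct.lid k H ((Coalgebra.counit (R := k)).rTensor H t)) := by
    intro t
    induction t with
    | zero => simp
    | add t t' ht ht' => simp only [map_add, ht, ht']
    | tmul p q => simp [← Algebra.smul_def]
  have h4 : ∀ t : H ⊗[k] H, TensorProduct.map (HopfAlgebra.antipode k)
        (LinearMap.mul' k H ∘ₗ G.lTensor H ∘ₗ Coalgebra.comul (R := k)) t =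
      TensorProduct.map (HopfAlgebra.antipode k) (LinearMap.mul' k H ∘ₗ G.lTensor H)
        ((Coalgebra.comul (R := k)).lTensor H t) := by
    intro t
    induction t with
    | zero => simp
    | add t t' ht ht' => simp only [map_add, ht, ht']
    | tmul p q => simp
  rw [h1, h4, h2, Coalgebra.coassoc_symm_apply, h3]
  simp [G]

theorem InvariantFunctionals.convolution_mem_hat (F : InvariantFunctionals k H)
    (ω : Module.Dual k H) {χ : Module.Dual k H} (hχ : χ ∈ F.hat) : convolution ω χ ∈ F.hat := by
  obtain ⟨h, rfl⟩ := hχ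
  refine ⟨TensorProduct.lid k H (TensorProduct.map (ω ∘ₗ HopfAlgebra.antipode k) LinearMap.id
    (Coalgebra.comul (R := k) h)), LinearMap.ext fun x => ?_⟩
  have h1 : ∀ t : H ⊗[k] H, LinearMap.mul' k k (TensorProduct.map ω (translate F.φ h) t) =
      ω (TensorProduct.rid k H ((translate F.φ h).lTensor H t)) := by
    intro t
    induction t with
    | zero => simp
    | add t t' ht ht' => simp only [map_add, ht, ht']
    | tmul p q => simp [mul_comm]
  have h2 : ∀ t : H ⊗[k] H, ω (TensorProduct.rid k H (TensorProduct.map (HopfAlgebra.antipode k)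
        ((LinearMap.applyₗ x) ∘ₗ translate F.φ) t)) =
      translate F.φ (TensorProduct.lid k H
        (TensorProduct.map (ω ∘ₗ HopfAlgebra.antipode k) LinearMap.id t)) x := by
    intro t
    induction t with
    | zero => simp
    | add t t' ht ht' => simp only [map_add, ht, ht', LinearMap.add_apply]
    | tmul p q => simp [mul_comm]
  change _ = LinearMap.mul' k k (TensorProduct.map ω (translate F.φ h) _)
  rw [h1, strong_invariance, h2]

/-- The convolution product `ω * χ ∈ Ĥ` for `ω ∈ H^*` and `χ ∈ Ĥ`. -/
def InvariantFunctionals.convHat (F : InvariantFunctionals k H) :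
    Module.Dual k H →ₗ[k] F.hat →ₗ[k] F.hat :=
  LinearMap.mk₂ k (fun ω χ => ⟨convolution ω χ, F.convolution_mem_hat ω χ.2⟩)
    (fun _ _ _ => by ext; simp) (fun _ _ _ => by ext; simp)
    (fun _ _ _ => by ext; simp) (fun _ _ _ => by ext; simp)

end Dual

section Smash

variable {k : Type u} [Field k] {H : Type v} [Ring H] [HopfAlgebra k H]
  {A : Type w} [NonUnitalRing A] [Module k A] [IsScalarTower k A A] [SMulCommClass k A A]

/-- The smash product `A # Ĥ`; its underlying vector space is `A ⊗ Ĥ`. -/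
def SmashProduct (_α : ComoduleAlgebra k H A) (F : InvariantFunctionals k H) :
    Type (max u v w) :=
  A ⊗[k] F.hat

namespace SmashProduct

variable (α : ComoduleAlgebra k H A) (F : InvariantFunctionals k H)

instance : AddCommGroup (SmashProduct α F) := inferInstanceAs (AddCommGroup (A ⊗[k] F.hat))

instance : Module k (SmashProduct α F) := inferInstanceAs (Module k (A ⊗[k] F.hat))

/-- The product `(a ⊗ ω)(b ⊗ χ) = a b₍₀₎ ⊗ ω(b₍₁₎-) * χ` on `A ⊗ Ĥ`. -/
def mulMap : A ⊗[k] F.hat →ₗ[k] A ⊗[k] F.hat →ₗ[k] A ⊗[k] F.hat :=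
  TensorProduct.lift <| LinearMap.mk₂ k
    (fun a ω => TensorProduct.lift <| LinearMap.mk₂ k
      (fun b χ => TensorProduct.map (LinearMap.mul k A a)
        (F.convHat.flip χ ∘ₗ translate (ω : Module.Dual k H)) (α.coact b))
      (fun _ _ _ => by simp)
      (fun _ _ _ => by simp)
      (fun _ _ _ => by
        simp [LinearMap.add_comp, TensorProduct.map_add_right])
      (fun _ _ _ => by
        simp [LinearMap.smul_comp, TensorProduct.map_smul_right]))
    (fun _ _ _ => by
      ext b χ
      simp [TensorProduct.map_add_left])
    (fun _ _ _ => by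
      ext b χ
      simp [TensorProduct.map_smul_left])
    (fun _ _ _ => by
      ext b χ
      simp [LinearMap.comp_add, TensorProduct.map_add_right])
    (fun _ _ _ => by
      ext b χ
      simp [LinearMap.comp_smul, TensorProduct.map_smul_right])

theorem mulMap_tmul (a b : A) (ω χ : F.hat) :
    mulMap α F (a ⊗ₜ ω) (b ⊗ₜ χ) = TensorProduct.map (LinearMap.mul k A a)
      (F.convHat.flip χ ∘ₗ translate (ω : Module.Dual k H)) (α.coact b) := by
  simp [mulMap]

theorem mulMap_assoc (x y z : A ⊗[k] F.hat) :
    mulMap α F (mulMap α F x y) z = mulMap α F x (mulMap α F y z) := by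
  induction x with
  | zero => simp
  | add x x' hx hx' => simp only [map_add, LinearMap.add_apply, hx, hx']
  | tmul a ω =>
  induction y with
  | zero => simp
  | add y y' hy hy' => simp only [map_add, LinearMap.add_apply, hy, hy']
  | tmul b χ =>
  induction z with
  | zero => simp
  | add z z' hz hz' => simp only [map_add, hz, hz']
  | tmul c θ =>
  -- `Q s` is the map `u ⊗ g ↦ (L_a ⊗ Φ_g)(s u)` with `Φ_g(h) = ω(h-) * (χ(g-) * θ)`
  let P : H →ₗ[k] A ⊗[k] H →ₗ[k] A ⊗[k] F.hat :=
    TensorProduct.mapBilinear (RingHom.id k) A H A F.hat (LinearMap.mul k A a) ∘ₗ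
      (LinearMap.lcomp k F.hat (translate (ω : Module.Dual k H)) ∘ₗ F.convHat.flip) ∘ₗ
        F.convHat.flip θ ∘ₗ translate (χ : Module.Dual k H)
  have hP : ∀ g u, P g u = TensorProduct.map (LinearMap.mul k A a)
      (F.convHat.flip (F.convHat (translate (χ : Module.Dual k H) g) θ) ∘ₗ
        translate (ω : Module.Dual k H)) u := fun _ _ => rfl
  let Q : A ⊗[k] H → (A ⊗[k] H) ⊗[k] H →ₗ[k] A ⊗[k] F.hat := fun s =>
    TensorProduct.lift (P.flip ∘ₗ LinearMap.mul k (A ⊗[k] H) s)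
  have hQ : ∀ s u g, Q s (u ⊗ₜ g) = P g (s * u) := fun _ _ _ => rfl
  have hQadd : ∀ s s' t, Q (s + s') t = Q s t + Q s' t := by
    intro s s' t
    induction t with
    | zero => simp
    | add t t' ht ht' => rw [map_add, map_add, map_add, ht, ht']; abel
    | tmul u g => simp only [hQ, add_mul, map_add]
  clear_value P Q
  have hR : ∀ t : A ⊗[k] H, mulMap α F (a ⊗ₜ ω) (TensorProduct.map (LinearMap.mul k A b)
      (F.convHat.flip θ ∘ₗ translate (χ : Module.Dual k H)) t) =
      Q (α.coact b) (α.coact.rTensor H t) := by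
    intro t
    induction t with
    | zero => simp
    | add t t' ht ht' => simp only [map_add, ht, ht']
    | tmul p g => simp [mulMap_tmul, hQ, hP, α.map_mul]
  have hL : ∀ s t : A ⊗[k] H, ∀ c : A, α.coact c = t →
      mulMap α F (TensorProduct.map (LinearMap.mul k A a)
        (F.convHat.flip χ ∘ₗ translate (ω : Module.Dual k H)) s) (c ⊗ₜ θ) =
      Q s ((TensorProduct.assoc k A H H).symm
        ((Coalgebra.comul (R := k) (A := H)).lTensor A t)) := by
    intro s t c hc
    induction s with
    | zero =>
      have h0 : ∀ t, Q 0 t = 0 := fun t => by simpa using hQadd 0 0 t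
      simp [h0]
    | add s s' hs hs' => simp only [map_add, LinearMap.add_apply, hQadd, hs, hs']
    | tmul p h =>
      rw [TensorProduct.map_tmul, mulMap_tmul, hc]
      clear hc
      induction t with
      | zero => simp
      | add t t' ht ht' => simp only [map_add, ht, ht']
      | tmul q g =>
        have key : F.convHat (translate (F.convHat (translate (ω : Module.Dual k H) h) χ :
            Module.Dual k H) g) θ = TensorProduct.lift ((F.convHat.compl₁₂
              (translate (translate (ω : Module.Dual k H) h))
              (F.convHat.flip θ ∘ₗ translate (χ : Module.Dual k H))))
              (Coalgebra.comul (R := k) g) := by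
          apply Subtype.ext
          change convolution (translate (convolution _ _) g) _ = _
          rw [translate_convolution]
          generalize Coalgebra.comul (R := k) g = d
          induction d with
          | zero => simp
          | add d d' hd hd' =>
            simp only [map_add, LinearMap.add_apply, hd, hd', Submodule.coe_add]
          | tmul y z => exact convolution_assoc _ _ _
        simp only [TensorProduct.map_tmul, LinearMap.comp_apply, LinearMap.flip_apply,
          LinearMap.lTensor_tmul, key]
        generalize Coalgebra.comul (R := k) g = d
        induction d with
        | zero => simp
        | add d d' hd hd' => simp only [map_add, TensorProduct.tmul_add, hd, hd']
        | tmul y z =>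
          simp [hQ, hP, translate_translate, mul_assoc]
  rw [mulMap_tmul, mulMap_tmul, hR, hL _ _ c rfl, ← α.isComodule.coassoc,
    LinearEquiv.symm_apply_apply]

instance : NonUnitalRing (SmashProduct α F) where
  mul x y := mulMap α F x y
  left_distrib x y z := map_add (mulMap α F x) y z
  right_distrib x y z := LinearMap.map_add₂ (mulMap α F) x y z
  zero_mul x := LinearMap.map_zero₂ (mulMap α F) x
  mul_zero x := map_zero (mulMap α F x)
  mul_assoc x y z := mulMap_assoc α F x y z

instance : IsScalarTower k (SmashProduct α F) (SmashProduct α F) where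
  smul_assoc c x y := LinearMap.map_smul₂ (mulMap α F) c x y

instance : SMulCommClass k (SmashProduct α F) (SmashProduct α F) where
  smul_comm c x y := ((mulMap α F x).map_smul c y).symm

end SmashProduct

end Smash

end

end HopfCoaction

/-! Write `D` for the smash product `A # Ĥ`. A functional `ω` acts on a comodule by `v ↦ v₍₀₎
ω(v₍₁₎)`, so an equivariant module carries the action `(a ⊗ ω) v = a (ω v)` of `D`. Nothing is lost
in this passage. Strong invariance implies that `Ĥ` separates the points of `H`
(`InvariantFunctionals.separatesPoints`). Hence a subspace is a subcomodule iff it is `Ĥ`-stable,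
also after extension of scalars, and some element of `Ĥ` acts like the counit on any given finite
set of vectors. Together with the local units of `A` this recovers the actions of `A` and `Ĥ` from
that of `D`. Equivariant submodules and `D`-submodules then coincide over every extension field, so
a unital equivariant module is equivariantly absolutely semisimple iff it is absolutely semisimple
over `D`. This is 2 ⇒ 1.

For 1 ⇒ 3, condition 1 is needed only for `A ⊗ Ĥ`, whose equivariant structure induces left
multiplication of `D` on itself. So `D` is a direct sum of absolutely simple left ideals `S_j`. By
Schur's lemma a homomorphism between two of them is zero or bijective, and their endomorphisms are
scalars: the centre of a suitable commutant is an extension field `L` of `k`, and simplicity of `L ⊗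
S_j` forces `L = k`. The projections onto one `S_j` from each isomorphism class are idempotents
`e_i` in the endomorphism algebra `B` of the left module `D`. The subspace `E` that they span
satisfies `E B E = E ≅ k_I`, and a strict Morita context between `D` (as right multiplications) and
`k_I` is found inside `B`.

For 3 ⇒ 2, inserting the idempotents of `k_I` into the products of the context shows that `D` is
spanned by elements `[x, q]_i` multiplying like operators of rank one. In a unital module the
vectors `[x, p]_i m`, for fixed `i, p, m`, form a submodule that is zero or absolutely simple, since
operators of rank one survive extension of scalars. Such submodules span the module, and a sum of
simple submodules can be refined to a direct sum. -/

namespace HopfCoaction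

/-! ## Slice maps -/

section Slice

variable {k : Type*} [Field k] {U : Type*} [AddCommGroup U] [Module k U]
  {U' : Type*} [AddCommGroup U'] [Module k U'] {H : Type*} [AddCommGroup H] [Module k H]

/-- The slice map `id ⊗ ω : U ⊗ H → U`, as a linear function of `ω`. -/
noncomputable def slice : Module.Dual k H →ₗ[k] U ⊗[k] H →ₗ[k] U :=
  LinearMap.mk₂ k (fun ω z => TensorProduct.rid k U (ω.lTensor U z))
    (fun _ _ _ => by simp [LinearMap.lTensor_add]) (fun _ _ _ => by simp [LinearMap.lTensor_smul])
    (fun _ _ _ => by simp) (fun _ _ _ => by simp)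

theorem slice_def (ω : Module.Dual k H) (z : U ⊗[k] H) :
    slice ω z = TensorProduct.rid k U (ω.lTensor U z) := rfl

@[simp]
theorem slice_tmul (ω : Module.Dual k H) (x : U) (h : H) :
    slice ω (x ⊗ₜ[k] h) = ω h • x := by
  simp [slice]

theorem slice_rTensor (ω : Module.Dual k H) (f : U →ₗ[k] U') (z : U ⊗[k] H) :
    slice ω (f.rTensor H z) = f (slice ω z) := by
  induction z with
  | zero => simp
  | add z z' hz hz' => simp only [map_add, hz, hz']
  | tmul x h => simp

/-- A set of functionals on `H` separates points. -/
def SeparatesPoints (Ω : Set (Module.Dual k H)) : Prop :=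
  ∀ h : H, (∀ ω ∈ Ω, ω h = 0) → h = 0

/-- Slicing acts coefficientwise once a basis of `U` is fixed. Linear independence then isolates one
coefficient, which reduces statements about `U ⊗ H` to statements about `H`. -/
theorem slice_basis_sum {ι : Type*} (b : Module.Basis ι k U) (c : ι →₀ H) (ω : Module.Dual k H) :
    slice ω (c.sum fun i h => b i ⊗ₜ[k] h) = Finsupp.linearCombination k b
      (c.mapRange ω (map_zero ω)) := by
  rw [Finsupp.linearCombination_apply, Finsupp.sum_mapRange_index (by simp)]
  simp [Finsupp.sum, map_sum]

theorem SeparatesPoints.eq_zero_of_slice_eq_zero {Ω : Set (Module.Dual k H)}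
    (hΩ : SeparatesPoints Ω) (z : U ⊗[k] H) (hz : ∀ ω ∈ Ω, slice ω z = 0) : z = 0 := by
  obtain ⟨c, rfl⟩ := TensorProduct.eq_repr_basis_left (Module.Basis.ofVectorSpace k U) z
  have hc : ∀ i, c i = 0 := fun i => hΩ _ fun ω hω => by
    have h := hz ω hω
    rw [slice_basis_sum] at h
    have h' := (Module.Basis.ofVectorSpace k U).linearIndependent (h.trans (map_zero _).symm)
    simpa using DFunLike.congr_fun h' i
  have : c = 0 := Finsupp.ext hc
  simp [this]

theorem SeparatesPoints.ext_slice {Ω : Set (Module.Dual k H)}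
    (hΩ : SeparatesPoints Ω) {z z' : U ⊗[k] H} (hz : ∀ ω ∈ Ω, slice ω z = slice ω z') :
    z = z' :=
  sub_eq_zero.1 (hΩ.eq_zero_of_slice_eq_zero _ fun ω hω => by rw [map_sub, hz ω hω, sub_self])

/-- By right exactness the range is the kernel of `U ⊗ H → (U/X) ⊗ H`, and slicing commutes with `U
→ U/X`. -/
theorem SeparatesPoints.mem_range_rTensor_iff {Ω : Set (Module.Dual k H)}
    (hΩ : SeparatesPoints Ω) (X : Submodule k U) (z : U ⊗[k] H) :
    z ∈ LinearMap.range (X.subtype.rTensor H) ↔ ∀ ω ∈ Ω, slice ω z ∈ X := by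
  rw [← rTensor_mkQ, LinearMap.mem_ker]
  refine ⟨fun h ω _ => ?_, fun h => hΩ.eq_zero_of_slice_eq_zero _ fun ω hω => ?_⟩
  · have := slice_rTensor ω X.mkQ z
    rw [h, map_zero] at this
    simpa using this.symm
  · rw [slice_rTensor]
    simpa using h ω hω

/-- Only finitely many elements of `H` occur in a tensor. This is the continuity that complements
the density of point-separating spaces of functionals. -/
theorem exists_finset_slice_eq (z : U ⊗[k] H) : ∃ t : Finset H, ∀ ω η : Module.Dual k H,
    (∀ h ∈ t, ω h = η h) → slice ω z = slice η z := by
  classical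
  induction z with
  | zero => exact ⟨∅, by simp⟩
  | add z z' hz hz' =>
    obtain ⟨t, ht⟩ := hz
    obtain ⟨t', ht'⟩ := hz'
    refine ⟨t ∪ t', fun ω η h => ?_⟩
    rw [map_add, map_add, ht ω η fun x hx => h x (Finset.mem_union_left _ hx),
      ht' ω η fun x hx => h x (Finset.mem_union_right _ hx)]
  | tmul x h => exact ⟨{h}, fun ω η hω => by simp [hω h (by simp)]⟩

/-- A point-separating space of functionals is dense. -/
theorem SeparatesPoints.exists_eqOn_finset {Ω : Submodule k (Module.Dual k H)}
    (hΩ : SeparatesPoints (Ω : Set (Module.Dual k H))) (t : Finset H) (η : Module.Dual k H) :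
    ∃ ω ∈ Ω, ∀ h ∈ t, ω h = η h := by
  let ρ : Module.Dual k H →ₗ[k] (t → k) := LinearMap.pi fun h => LinearMap.applyₗ (h : H)
  by_contra hcon
  have hmem : ρ η ∉ Ω.map ρ := fun ⟨ω, hω, h⟩ =>
    hcon ⟨ω, hω, fun x hx => congrFun h ⟨x, hx⟩⟩
  -- A functional `f` on `k^t` kills the restrictions of all of `Ω` but not that of `η`. It is
  -- evaluation at an element of `H`, which must vanish because `Ω` separates points.
  obtain ⟨f, hf, hker⟩ := Submodule.exists_le_ker_of_notMem hmem
  classical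
  have hf' : ∀ ω : Module.Dual k H,
      f (ρ ω) = ω (∑ h : t, f (Pi.single h 1) • (h : H)) := fun ω => by
    conv_lhs => rw [← Finset.univ_sum_single (ρ ω)]
    rw [map_sum, map_sum]
    refine Finset.sum_congr rfl fun i _ => ?_
    have : Pi.single i (ρ ω i) = ω i • (Pi.single i (1 : k) : t → k) := by
      rw [← Pi.single_smul]; simp [ρ]
    rw [this, map_smul, map_smul, smul_eq_mul, smul_eq_mul, mul_comm]
  have h0 : ∑ h : t, f (Pi.single h 1) • (h : H) = 0 :=
    hΩ _ fun ω hω => by rw [← hf']; exact hker ⟨ω, hω, rfl⟩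
  exact hf (by rw [hf', h0, map_zero])

end Slice

/-! ## Faithfulness of invariant functionals -/

section Faithful

variable {k : Type u} [Field k] {H : Type v} [Ring H] [HopfAlgebra k H]

theorem InvariantFunctionals.translate_mem_hat (F : InvariantFunctionals k H) (h : H) :
    translate F.φ h ∈ F.hat := ⟨h, rfl⟩

/-- The functionals in `Ĥ` separate the points of `H`. -/
theorem InvariantFunctionals.separatesPoints (F : InvariantFunctionals k H) :
    SeparatesPoints (F.hat : Set (Module.Dual k H)) := by
  -- `N` is the radical of `(h, x) ↦ φ(hx)` in the second variable, a left ideal. It is shown that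
  -- `Δ(N) ⊆ H ⊗ N` and that the counit vanishes on `N`; the counit axiom then gives `N = 0`.
  let N : Submodule k H := LinearMap.ker (translate F.φ).flip
  have hN : ∀ x, x ∈ N ↔ ∀ h, F.φ (h * x) = 0 := fun x =>
    ⟨fun hx h => DFunLike.congr_fun (LinearMap.mem_ker.1 hx) h, fun hx => LinearMap.mem_ker.2
      (LinearMap.ext hx)⟩
  -- By strong invariance all slices of `Δ(x)` by `φ(h-)` vanish, so its coefficients with respect
  -- to a basis of the first factor lie in `N`.
  have hrep : ∀ x ∈ N, Coalgebra.comul (R := k) x ∈ LinearMap.range (N.subtype.lTensor H) := by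
    intro x hx
    obtain ⟨c, hc⟩ := TensorProduct.eq_repr_basis_left (Module.Basis.ofVectorSpace k H)
      (Coalgebra.comul (R := k) x)
    have hcN : ∀ i, c i ∈ N := fun i => (hN _).2 fun h => by
      have h1 := F.strong_invariance h x
      have h2 : LinearMap.applyₗ x ∘ₗ translate F.φ = 0 := LinearMap.ext fun g => (hN x).1 hx g
      rw [h2, TensorProduct.map_zero_right, LinearMap.zero_apply, map_zero, ← slice_def, ← hc,
        slice_basis_sum] at h1
      simpa [translate] using DFunLike.congr_fun
        ((Module.Basis.ofVectorSpace k H).linearIndependent (h1.trans (map_zero _).symm)) i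
    rw [← hc]
    exact Submodule.sum_mem _ fun i _ => ⟨_ ⊗ₜ ⟨c i, hcN i⟩, rfl⟩
  -- As `N` is a left ideal, `S(x₍₁₎) x₍₂₎ = ε(x) 1` lies in `N`. Hence `ε(x) φ(g) = 0` for all `g`,
  -- while `φ ≠ 0`.
  have hcounit : ∀ x ∈ N, Coalgebra.counit (R := k) x = 0 := by
    intro x hx
    obtain ⟨z, hz⟩ := hrep x hx
    have h1 : ∀ z : H ⊗[k] N, LinearMap.mul' k H ((HopfAlgebra.antipode k).rTensor H
        (N.subtype.lTensor H z)) ∈ N := by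
      intro z
      induction z with
      | zero => simp
      | add z z' hz hz' => simpa only [map_add] using N.add_mem hz hz'
      | tmul g n =>
        refine (hN _).2 fun h => ?_
        simpa [mul_assoc] using (hN n).1 n.2 (h * HopfAlgebra.antipode k g)
    have h2 := h1 z
    rw [hz, HopfAlgebra.mul_antipode_rTensor_comul_apply] at h2
    by_contra hne
    apply F.φ_ne_zero
    ext g
    have h3 := (hN _).1 h2 g
    rw [← Algebra.commutes, ← Algebra.smul_def, map_smul, smul_eq_mul] at h3
    simpa [hne] using h3
  intro x hx
  have hxN : x ∈ N := (hN x).2 fun h => hx _ (F.translate_mem_hat h)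
  obtain ⟨z, hz⟩ := hrep x hxN
  have h1 : ∀ z : H ⊗[k] N, (Coalgebra.counit (R := k)).lTensor H (N.subtype.lTensor H z) = 0 := by
    intro z
    induction z with
    | zero => simp
    | add z z' hz hz' => simp only [map_add, hz, hz', add_zero]
    | tmul g n => simp [hcounit n n.2]
  have h2 := h1 z
  rw [hz, Coalgebra.lTensor_counit_comul] at h2
  simpa using congrArg (TensorProduct.rid k H) h2

end Faithful

/-! ## The action of the dual on a comodule -/

section CoactionSlice

variable {k : Type*} [Field k] {V : Type*} [AddCommGroup V] [Module k V]

theorem slice_lTensor {H H' : Type*} [AddCommGroup H] [Module k H] [AddCommGroup H'] [Module k H']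
    (η : Module.Dual k H') (g : H →ₗ[k] H') (z : V ⊗[k] H) :
    slice η (g.lTensor V z) = slice (η ∘ₗ g) z := by
  induction z with
  | zero => simp
  | add z z' hz hz' => simp only [map_add, hz, hz']
  | tmul x h => simp

/-- The functional `g ⊗ h ↦ ω(g) χ(h)` on `H ⊗ H`. -/
noncomputable def tensorDual {H : Type*} [AddCommGroup H] [Module k H] (ω χ : Module.Dual k H) :
    Module.Dual k (H ⊗[k] H) :=
  LinearMap.mul' k k ∘ₗ TensorProduct.map ω χ

theorem tensorDual_apply {H : Type*} [AddCommGroup H] [Module k H] (ω χ : Module.Dual k H)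
    (z : H ⊗[k] H) : tensorDual ω χ z = ω (slice χ z) := by
  induction z with
  | zero => simp
  | add z z' hz hz' => simp only [map_add, hz, hz']
  | tmul x h => simp [tensorDual, mul_comm]

theorem SeparatesPoints.tensorDual {H : Type*} [AddCommGroup H] [Module k H]
    {Ω : Set (Module.Dual k H)} (hΩ : SeparatesPoints Ω) :
    SeparatesPoints (Set.image2 tensorDual Ω Ω) := fun z hz =>
  hΩ.eq_zero_of_slice_eq_zero z fun χ hχ => hΩ _ fun ω hω => by
    rw [← tensorDual_apply]; exact hz _ ⟨ω, hω, χ, hχ, rfl⟩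

/-- The action `v ↦ v₍₀₎ ω(v₍₁₎)` of a functional on a comodule. -/
noncomputable def dualAction {H : Type*} [AddCommGroup H] [Module k H] (δ : V →ₗ[k] V ⊗[k] H) :
    Module.Dual k H →ₗ[k] V →ₗ[k] V :=
  slice.compl₂ δ

theorem dualAction_apply {H : Type*} [AddCommGroup H] [Module k H] (δ : V →ₗ[k] V ⊗[k] H)
    (ω : Module.Dual k H) (m : V) : dualAction δ ω m = slice ω (δ m) := rfl

theorem slice_tensorDual_assoc {H : Type*} [AddCommGroup H] [Module k H] (δ : V →ₗ[k] V ⊗[k] H)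
    (ω χ : Module.Dual k H) (z : V ⊗[k] H) :
    slice (tensorDual ω χ) (TensorProduct.assoc k V H H (δ.rTensor H z)) =
      dualAction δ ω (slice χ z) := by
  induction z with
  | zero => simp
  | add z z' hz hz' => simp only [map_add, hz, hz']
  | tmul x h =>
    simp only [LinearMap.rTensor_tmul, slice_tmul, map_smul, dualAction_apply]
    generalize δ x = t
    induction t with
    | zero => simp
    | add t t' ht ht' => simp only [map_add, TensorProduct.add_tmul, ht, ht', smul_add]
    | tmul y g => simp [tensorDual, smul_smul, mul_comm]

variable {H : Type*} [Ring H] [HopfAlgebra k H]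

theorem slice_convolution (ω χ : Module.Dual k H) (z : V ⊗[k] H) :
    slice (convolution ω χ) z =
      slice (tensorDual ω χ) ((Coalgebra.comul (R := k) (A := H)).lTensor V z) := by
  rw [slice_lTensor]; rfl

/-- This is coassociativity sliced by `ω ⊗ χ`. -/
theorem IsComodule.dualAction_convolution {δ : V →ₗ[k] V ⊗[k] H} (hδ : IsComodule δ)
    (ω χ : Module.Dual k H) (m : V) :
    dualAction δ (convolution ω χ) m = dualAction δ ω (dualAction δ χ m) := by
  rw [dualAction_apply, slice_convolution, ← hδ.coassoc, slice_tensorDual_assoc]; rfl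

/-- A map `δ : V → V ⊗ H` is a comodule structure as soon as it defines a module structure over
a point-separating set of functionals. -/
theorem isComodule_of_dualAction {δ : V →ₗ[k] V ⊗[k] H} {Ω : Set (Module.Dual k H)}
    (hΩ : SeparatesPoints Ω)
    (h1 : ∀ ω ∈ Ω, ∀ χ ∈ Ω, ∀ m : V,
      dualAction δ (convolution ω χ) m = dualAction δ ω (dualAction δ χ m))
    (h2 : ∀ m : V, dualAction δ (Coalgebra.counit (R := k) (A := H)) m = m) :
    IsComodule δ where
  coassoc m := hΩ.tensorDual.ext_slice <| by
    rintro _ ⟨ω, hω, χ, hχ, rfl⟩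
    rw [slice_tensorDual_assoc, ← slice_convolution]
    exact (h1 ω hω χ hχ m).symm
  counit := h2

/-- The counit acts as the identity, and by density some element of `Ω` agrees with it on the
finitely many elements of `H` that occur in `δ(m)` for `m ∈ s`. -/
theorem exists_dualAction_eq {Ω : Submodule k (Module.Dual k H)}
    (hΩ : SeparatesPoints (Ω : Set (Module.Dual k H))) {δ : V →ₗ[k] V ⊗[k] H} (hδ : IsComodule δ)
    (s : Finset V) : ∃ ω ∈ Ω, ∀ m ∈ s, dualAction δ ω m = m := by
  classical
  choose t ht using fun m : V => exists_finset_slice_eq (δ m)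
  obtain ⟨ω, hω, h⟩ := hΩ.exists_eqOn_finset (s.biUnion t) (Coalgebra.counit (R := k) (A := H))
  refine ⟨ω, hω, fun m hm => ?_⟩
  rw [dualAction_apply, ht m ω _ fun x hx => h x (Finset.mem_biUnion.2 ⟨m, hm, hx⟩)]
  exact hδ.counit m

end CoactionSlice

/-! ### Subcomodules and extension of scalars -/

section CoactionBaseChange

variable {k : Type*} [Field k] {V : Type*} [AddCommGroup V] [Module k V]
  {H : Type*} [AddCommGroup H] [Module k H] (K : Type*) [Field K] [Algebra k K]

/-- The `K`-linear extension of a functional. -/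
noncomputable def baseChangeDual (ω : Module.Dual k H) : Module.Dual K (K ⊗[k] H) :=
  (TensorProduct.AlgebraTensorModule.rid k K K).toLinearMap ∘ₗ LinearMap.baseChange K ω

@[simp]
theorem baseChangeDual_tmul (ω : Module.Dual k H) (c : K) (h : H) :
    baseChangeDual K ω (c ⊗ₜ h) = ω h • c := by
  simp [baseChangeDual]

/-- The `K`-linear extension of `ω` is the slice map `id ⊗ ω : K ⊗ H → K`, so the vanishing
criterion for slices applies with `U = K`. -/
theorem SeparatesPoints.baseChange {Ω : Set (Module.Dual k H)} (hΩ : SeparatesPoints Ω) :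
    SeparatesPoints (baseChangeDual K '' Ω) := fun z hz =>
  hΩ.eq_zero_of_slice_eq_zero z fun ω hω => by
    rw [← hz _ ⟨ω, hω, rfl⟩]
    generalize z = z
    induction z with
    | zero => simp
    | add z z' hz hz' => simp only [map_add, hz, hz']
    | tmul x h => simp

theorem dualAction_baseChangeCoaction (δ : V →ₗ[k] V ⊗[k] H) (ω : Module.Dual k H) :
    dualAction (baseChangeCoaction K δ) (baseChangeDual K ω) = (dualAction δ ω).baseChange K := by
  ext m
  change slice (baseChangeDual K ω) (TensorProduct.AlgebraTensorModule.distribBaseChange k K V H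
    (δ.baseChange K (1 ⊗ₜ m))) = (dualAction δ ω).baseChange K (1 ⊗ₜ m)
  simp only [LinearMap.baseChange_tmul, dualAction_apply]
  generalize δ m = z
  induction z with
  | zero => simp
  | add z z' hz hz' => simp only [map_add, TensorProduct.tmul_add, hz, hz']
  | tmul x h => simp [TensorProduct.smul_tmul']

theorem isSubcomodule_iff {Ω : Set (Module.Dual k H)} (hΩ : SeparatesPoints Ω)
    (δ : V →ₗ[k] V ⊗[k] H) (W : Submodule k V) :
    IsSubcomodule δ W ↔ ∀ ω ∈ Ω, ∀ m ∈ W, dualAction δ ω m ∈ W := by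
  simp only [IsSubcomodule, hΩ.mem_range_rTensor_iff]
  exact ⟨fun h ω hω m hm => h m hm ω hω, fun h m hm ω hω => h ω hω m hm⟩

/-- Functionals defined over `k` suffice to detect subcomodules over `K`, so no invariant
functionals on `K ⊗ H` have to be constructed. -/
theorem isSubcomodule_baseChange_iff {Ω : Set (Module.Dual k H)} (hΩ : SeparatesPoints Ω)
    (δ : V →ₗ[k] V ⊗[k] H) (X : Submodule K (K ⊗[k] V)) :
    IsSubcomodule (baseChangeCoaction K δ) X ↔
      ∀ ω ∈ Ω, ∀ m ∈ X, (dualAction δ ω).baseChange K m ∈ X := by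
  rw [isSubcomodule_iff (hΩ.baseChange K), Set.forall_mem_image]
  simp only [dualAction_baseChangeCoaction]

theorem dualAction_restrictCoaction (δ : V →ₗ[k] V ⊗[k] H) (W : Submodule k V)
    (hW : IsSubcomodule δ W) (ω : Module.Dual k H) (m : W) :
    (dualAction (restrictCoaction δ W hW) ω m : V) = dualAction δ ω m := by
  rw [dualAction_apply, dualAction_apply, ← rTensor_restrictCoaction δ W hW, slice_rTensor]
  rfl

/-- This and its analogue for `K ⊗ V` carry local units over to tensor products: a tensor involves
only finitely many vectors of `V`. -/
theorem exists_finset_rTensor_eq {U : Type*} [AddCommMonoid U] [Module k U] (z : V ⊗[k] U) :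
    ∃ s : Finset V, ∀ f : V →ₗ[k] V, (∀ m ∈ s, f m = m) → f.rTensor U z = z := by
  classical
  induction z with
  | zero => exact ⟨∅, by simp⟩
  | add z z' hz hz' =>
    obtain ⟨t, ht⟩ := hz
    obtain ⟨t', ht'⟩ := hz'
    refine ⟨t ∪ t', fun f h => ?_⟩
    rw [map_add, ht f fun x hx => h x (Finset.mem_union_left _ hx),
      ht' f fun x hx => h x (Finset.mem_union_right _ hx)]
  | tmul a x => exact ⟨{a}, fun f hf => by simp [hf a (by simp)]⟩

theorem exists_finset_baseChange_eq (x : K ⊗[k] V) : ∃ s : Finset V, ∀ f : V →ₗ[k] V,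
    (∀ m ∈ s, f m = m) → f.baseChange K x = x := by
  classical
  induction x with
  | zero => exact ⟨∅, by simp⟩
  | add z z' hz hz' =>
    obtain ⟨t, ht⟩ := hz
    obtain ⟨t', ht'⟩ := hz'
    refine ⟨t ∪ t', fun f h => ?_⟩
    rw [map_add, ht f fun x hx => h x (Finset.mem_union_left _ hx),
      ht' f fun x hx => h x (Finset.mem_union_right _ hx)]
  | tmul c m => exact ⟨{m}, fun f hf => by simp [hf m (by simp)]⟩

theorem baseChangeAction_tmul_apply {D : Type*} [AddCommGroup D] [Module k D]
    (act : D →ₗ[k] V →ₗ[k] V) (c : K) (x : D) (m : K ⊗[k] V) :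
    baseChangeAction K act (c ⊗ₜ x) m = c • (act x).baseChange K m := by
  simp [baseChangeAction]

theorem isInvariant_baseChangeAction_iff {D : Type*} [AddCommGroup D] [Module k D]
    (act : D →ₗ[k] V →ₗ[k] V) (X : Submodule K (K ⊗[k] V)) :
    IsInvariant (baseChangeAction K act) X ↔ ∀ x, ∀ m ∈ X, (act x).baseChange K m ∈ X := by
  refine ⟨fun h x m hm => ?_, fun h x m hm => ?_⟩
  · simpa [baseChangeAction_tmul_apply] using h (1 ⊗ₜ x) m hm
  · induction x with
    | zero => simp
    | add x y hx hy => rw [map_add, LinearMap.add_apply]; exact X.add_mem hx hy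
    | tmul c x => rw [baseChangeAction_tmul_apply]; exact X.smul_mem _ (h x m hm)

end CoactionBaseChange

/-! ## Equivariant modules as modules over the smash product -/

section SmashAction

variable {k : Type u} [Field k] {H : Type v} [Ring H] [HopfAlgebra k H]
  {A : Type w} [AddCommGroup A] [Module k A] {V : Type*} [AddCommGroup V] [Module k V]

/-- The action `(a ⊗ ω) v = a v₍₀₎ ω(v₍₁₎)` of `A ⊗ Ĥ`. -/
noncomputable def smashAction (F : InvariantFunctionals k H) (act : A →ₗ[k] V →ₗ[k] V)
    (δ : V →ₗ[k] V ⊗[k] H) : A ⊗[k] F.hat →ₗ[k] V →ₗ[k] V :=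
  TensorProduct.lift ((LinearMap.mul k (Module.End k V)).compl₁₂ act (dualAction δ ∘ₗ F.hat.subtype))

variable (F : InvariantFunctionals k H) (act : A →ₗ[k] V →ₗ[k] V) (δ : V →ₗ[k] V ⊗[k] H)

theorem smashAction_tmul (a : A) (ω : F.hat) (m : V) :
    smashAction F act δ (a ⊗ₜ ω) m = act a (dualAction δ ω m) := rfl

theorem smashAction_tmul_eq_comp (a : A) (ω : F.hat) :
    smashAction F act δ (a ⊗ₜ ω) = act a ∘ₗ dualAction δ ω := rfl

theorem isInvariant_smashAction_iff_tmul (W : Submodule k V) :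
    IsInvariant (smashAction F act δ) W ↔
      ∀ a ω, ∀ m ∈ W, smashAction F act δ (a ⊗ₜ ω) m ∈ W := by
  refine ⟨fun h x y m hm => h _ m hm, fun h x m hm => ?_⟩
  induction x with
  | zero => simp
  | add x y hx hy => rw [map_add, LinearMap.add_apply]; exact W.add_mem hx hy
  | tmul x y => exact h x y m hm

/-- Local units for an `A`-module with coaction: finitely many vectors are fixed by some
element of `A` and by some functional in `Ĥ`. -/
def HasLocalUnitAction : Prop :=
  ∀ s : Finset V, ∃ e : A, ∃ ω : F.hat, ∀ m ∈ s, act e m = m ∧ dualAction δ (ω : Module.Dual k H) m = m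

variable {F act δ}

theorem HasLocalUnitAction.exists_fix (h : HasLocalUnitAction F act δ) (s : Finset V) :
    ∃ x, ∀ m ∈ s, smashAction F act δ x m = m := by
  obtain ⟨e, ω, he⟩ := h s
  exact ⟨e ⊗ₜ ω, fun m hm => by rw [smashAction_tmul, (he m hm).2, (he m hm).1]⟩

/-- Each factor of the action is recovered with a local unit for the other: `a m = (a ⊗ ω) m` if `ω`
fixes `m`, and `ω m = (e ⊗ ω) m` if `e` fixes `ω m`. -/
theorem HasLocalUnitAction.isInvariant_smashAction_iff (h : HasLocalUnitAction F act δ)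
    (W : Submodule k V) :
    IsInvariant (smashAction F act δ) W ↔ IsInvariant act W ∧ IsSubcomodule δ W := by
  rw [isSubcomodule_iff F.separatesPoints]
  rw [isInvariant_smashAction_iff_tmul]
  constructor
  · refine fun hW => ⟨fun a m hm => ?_, fun ω hω m hm => ?_⟩
    · obtain ⟨e, ω, he⟩ := h {m}
      simpa [smashAction_tmul, (he m (by simp)).2] using hW a ω m hm
    · obtain ⟨e, _, he⟩ := h {dualAction δ ω m}
      simpa [smashAction_tmul, (he _ (Finset.mem_singleton_self _)).1] using hW e ⟨ω, hω⟩ m hm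
  · exact fun hW a ω m hm => hW.1 a _ (hW.2 ω ω.2 m hm)

/-- The argument is the same as over `k`: local units for finitely many vectors of `V` also fix a
given element of `K ⊗ V`. -/
theorem HasLocalUnitAction.isInvariant_baseChange_smashAction_iff
    (h : HasLocalUnitAction F act δ) (K : Type*) [Field K] [Algebra k K]
    (X : Submodule K (K ⊗[k] V)) :
    IsInvariant (baseChangeAction K (smashAction F act δ)) X ↔
      IsInvariant (baseChangeAction K act) X ∧ IsSubcomodule (baseChangeCoaction K δ) X := by
  rw [isSubcomodule_baseChange_iff K F.separatesPoints, isInvariant_baseChangeAction_iff,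
    isInvariant_baseChangeAction_iff]
  constructor
  · refine fun hW => ⟨fun a x hx => ?_, fun ω hω x hx => ?_⟩
    · obtain ⟨s, hs⟩ := exists_finset_baseChange_eq K x
      obtain ⟨e, ω, he⟩ := h s
      have := hW (a ⊗ₜ ω) x hx
      rwa [smashAction_tmul_eq_comp, LinearMap.baseChange_comp, LinearMap.comp_apply,
        hs _ fun m hm => (he m hm).2] at this
    · obtain ⟨s, hs⟩ := exists_finset_baseChange_eq K ((dualAction δ ω).baseChange K x)
      obtain ⟨e, _, he⟩ := h s
      have := hW (e ⊗ₜ ⟨ω, hω⟩) x hx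
      rwa [smashAction_tmul_eq_comp, LinearMap.baseChange_comp, LinearMap.comp_apply,
        hs _ fun m hm => (he m hm).1] at this
  · rintro ⟨h1, h2⟩ y x hx
    induction y with
    | zero => simp
    | add y z hy hz =>
      rw [map_add, LinearMap.baseChange_add, LinearMap.add_apply]; exact X.add_mem hy hz
    | tmul a ω =>
      rw [smashAction_tmul_eq_comp, LinearMap.baseChange_comp, LinearMap.comp_apply]
      exact h1 _ _ (h2 ω ω.2 x hx)

theorem HasLocalUnitAction.isSimpleAction_baseChange_iff
    (h : HasLocalUnitAction F act δ) (K : Type*) [Field K] [Algebra k K] :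
    IsSimpleAction (baseChangeAction K (smashAction F act δ)) ↔
      IsEquivariantlySimple (baseChangeAction K act) (baseChangeCoaction K δ) := by
  -- Local units fix every vector of `K ⊗ V` under either action, so both conditions amount to `K ⊗
  -- V ≠ 0`.
  have h0 : (∃ x m, baseChangeAction K (smashAction F act δ) x m ≠ 0) ↔
      ∃ a m, baseChangeAction K act a m ≠ 0 := by
    constructor
    · rintro ⟨x, m, hm⟩
      have hm0 : m ≠ 0 := fun h0 => hm (by rw [h0, map_zero])
      obtain ⟨s, hs⟩ := exists_finset_baseChange_eq K m
      obtain ⟨e, ω, he⟩ := h s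
      exact ⟨1 ⊗ₜ e, m, by
        rwa [baseChangeAction_tmul_apply, one_smul, hs (act e) fun m hm => (he m hm).1]⟩
    · rintro ⟨x, m, hm⟩
      have hm0 : m ≠ 0 := fun h0 => hm (by rw [h0, map_zero])
      obtain ⟨s, hs⟩ := exists_finset_baseChange_eq K m
      obtain ⟨e, he⟩ := h.exists_fix s
      exact ⟨1 ⊗ₜ e, m, by rwa [baseChangeAction_tmul_apply, one_smul, hs _ he]⟩
  rw [IsSimpleAction, IsEquivariantlySimple, h0]
  simp only [h.isInvariant_baseChange_smashAction_iff, and_imp]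

theorem HasLocalUnitAction.restrict (h : HasLocalUnitAction F act δ) (W : Submodule k V)
    (hW : IsInvariant act W) (hW' : IsSubcomodule δ W) :
    HasLocalUnitAction F (restrictAction act W hW) (restrictCoaction δ W hW') := by
  classical
  intro s
  obtain ⟨e, ω, he⟩ := h (s.image (↑))
  refine ⟨e, ω, fun m hm => ?_⟩
  have := he m (Finset.mem_image_of_mem _ hm)
  exact ⟨Subtype.ext this.1, Subtype.ext (by rw [dualAction_restrictCoaction, this.2])⟩

theorem restrictAction_smashAction (W : Submodule k V) (hW : IsInvariant act W)
    (hW' : IsSubcomodule δ W) (hs : IsInvariant (smashAction F act δ) W) :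
    restrictAction (smashAction F act δ) W hs =
      smashAction F (restrictAction act W hW) (restrictCoaction δ W hW') := by
  refine TensorProduct.ext' fun a ω => LinearMap.ext fun m => Subtype.ext ?_
  rw [smashAction_tmul]
  change smashAction F act δ (a ⊗ₜ ω) m = act a _
  rw [dualAction_restrictCoaction, smashAction_tmul]

end SmashAction

/-! ### Comparison of the two notions of absolute semisimplicity -/

section AbsolutelySemisimple

variable {k : Type u} [Field k] {H : Type v} [Ring H] [HopfAlgebra k H]
  {A : Type w} [AddCommGroup A] [Module k A] {V : Type*} [AddCommGroup V] [Module k V]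
  {F : InvariantFunctionals k H} {act : A →ₗ[k] V →ₗ[k] V} {δ : V →ₗ[k] V ⊗[k] H}

theorem HasLocalUnitAction.isAbsolutelySimpleAction_iff (h : HasLocalUnitAction F act δ) :
    IsAbsolutelySimpleAction (smashAction F act δ) ↔ IsEquivariantlyAbsolutelySimple act δ :=
  forall_congr' fun K => forall_congr' fun _ => forall_congr' fun _ =>
    h.isSimpleAction_baseChange_iff K

/-- The same family of subspaces serves as a decomposition on both sides, because local units are
inherited by equivariant submodules. -/
theorem HasLocalUnitAction.isAbsolutelySemisimpleAction_iff (h : HasLocalUnitAction F act δ) :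
    IsAbsolutelySemisimpleAction (smashAction F act δ) ↔
      IsEquivariantlyAbsolutelySemisimple act δ := by
  constructor
  · rintro ⟨ι, W, hW, hi, hs⟩
    have hW' := fun i => (h.isInvariant_smashAction_iff (W i)).1 (hW i)
    refine ⟨ι, W, fun i => (hW' i).1, fun i => (hW' i).2, hi, fun i => ?_⟩
    rw [← (h.restrict _ _ _).isAbsolutelySimpleAction_iff, ← restrictAction_smashAction _ _ _ (hW i)]
    exact hs i
  · rintro ⟨ι, W, hW, hW', hi, hs⟩
    have hW'' := fun i => (h.isInvariant_smashAction_iff (W i)).2 ⟨hW i, hW' i⟩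
    refine ⟨ι, W, hW'', hi, fun i => ?_⟩
    rw [restrictAction_smashAction _ (hW i) (hW' i), (h.restrict _ _ _).isAbsolutelySimpleAction_iff]
    exact hs i

end AbsolutelySemisimple

/-! ### The smash product action on a unital equivariant module -/

section Equivariant

variable {k : Type u} [Field k] {H : Type v} [Ring H] [HopfAlgebra k H]
  {A : Type w} [NonUnitalRing A] [Module k A] [IsScalarTower k A A] [SMulCommClass k A A]
  {α : ComoduleAlgebra k H A} (F : InvariantFunctionals k H)
  {V : Type*} [AddCommGroup V] [Module k V] {act : A →ₗ[k] V →ₗ[k] V} {δ : V →ₗ[k] V ⊗[k] H}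

omit [IsScalarTower k A A] [SMulCommClass k A A] in
theorem slice_map₂_tmul (act : A →ₗ[k] V →ₗ[k] V) (ω : Module.Dual k H) (a : A) (h : H)
    (z : V ⊗[k] H) :
    slice ω (TensorProduct.map₂ act (LinearMap.mul k H) (a ⊗ₜ h) z) =
      act a (slice (translate ω h) z) := by
  induction z with
  | zero => simp
  | add z z' hz hz' => simp only [map_add, hz, hz']
  | tmul x h => simp [translate]

-- Equivariance gives `ω (b m) = b₍₀₎ (ω(b₍₁₎-) m)`. The product of `A # Ĥ` is exactly this
-- commutation rule.
variable {F} in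
theorem IsEquivariantModule.smashAction_mulMap (hV : IsEquivariantModule α act δ)
    (x y : A ⊗[k] F.hat) (m : V) : smashAction F act δ (SmashProduct.mulMap α F x y) m =
      smashAction F act δ x (smashAction F act δ y m) := by
  induction x with
  | zero => simp
  | add x x' hx hx' => simp only [map_add, LinearMap.add_apply, hx, hx']
  | tmul a ω =>
  induction y with
  | zero => simp
  | add y y' hy hy' => simp only [map_add, LinearMap.add_apply, hy, hy']
  | tmul b χ =>
  rw [SmashProduct.mulMap_tmul, smashAction_tmul, smashAction_tmul, dualAction_apply,
    hV.equivariant]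
  generalize α.coact b = s
  induction s with
  | zero => simp
  | add s s' hs hs' => simp only [map_add, LinearMap.add_apply, hs, hs']
  | tmul c h =>
    rw [slice_map₂_tmul, TensorProduct.map_tmul, smashAction_tmul, ← dualAction_apply,
      ← hV.isComodule.dualAction_convolution, LinearMap.mul_apply', hV.isModuleAction]
    rfl

theorem IsEquivariantModule.isModuleAction_smashAction (hV : IsEquivariantModule α act δ) :
    IsModuleAction (D := SmashProduct α F) (smashAction F act δ) :=
  hV.smashAction_mulMap

/-- A vector of `DV` is a finite sum of vectors `x m'`, and a left unit for the elements `x`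
involved fixes it. -/
theorem IsUnitalAction.exists_fix {D : Type*} [AddCommGroup D] [Module k D] [Mul D]
    {act : D →ₗ[k] V →ₗ[k] V} (hact : ∀ (x y : D) (m : V), act (x * y) m = act x (act y m))
    (hu : IsUnitalAction act) (s : Finset V) :
    ∃ t : Finset D, ∀ e : D, (∀ x ∈ t, e * x = x) → ∀ m ∈ s, act e m = m := by
  classical
  have h1 : ∀ m : V, ∃ t : Finset D, ∀ e : D, (∀ x ∈ t, e * x = x) → act e m = m := by
    intro m
    have hm : m ∈ Submodule.span k {m : V | ∃ (x : D) (m' : V), act x m' = m} := hu ▸ trivial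
    induction hm using Submodule.span_induction with
    | mem m hm =>
      obtain ⟨x, m', rfl⟩ := hm
      exact ⟨{x}, fun e he => by rw [← hact, he x (by simp)]⟩
    | zero => exact ⟨∅, by simp⟩
    | add m m' _ _ h h' =>
      obtain ⟨t, ht⟩ := h
      obtain ⟨t', ht'⟩ := h'
      exact ⟨t ∪ t', fun e h => by
        rw [map_add, ht e fun x hx => h x (Finset.mem_union_left _ hx),
          ht' e fun x hx => h x (Finset.mem_union_right _ hx)]⟩
    | smul c m _ h =>
      obtain ⟨t, ht⟩ := h
      exact ⟨t, fun e he => by rw [map_smul, ht e he]⟩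
  choose t ht using h1
  exact ⟨s.biUnion t, fun e he m hm => ht m e fun x hx => he x (Finset.mem_biUnion.2 ⟨m, hm, hx⟩)⟩

theorem IsEquivariantModule.hasLocalUnitAction (hV : IsEquivariantModule α act δ)
    (hα : α.HasCoinvariantLocalUnits) (hu : IsUnitalAction act) : HasLocalUnitAction F act δ := by
  intro s
  obtain ⟨t, ht⟩ := hu.exists_fix hV.isModuleAction s
  obtain ⟨e, -, he⟩ := hα t
  obtain ⟨ω, hω, h⟩ := exists_dualAction_eq F.separatesPoints hV.isComodule s
  exact ⟨e, ⟨ω, hω⟩, fun m hm => ⟨ht e (fun x hx => (he x hx).1) m hm, h m hm⟩⟩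

omit [IsScalarTower k A A] [SMulCommClass k A A] in
theorem HasLocalUnitAction.isUnitalAction_smashAction (h : HasLocalUnitAction F act δ) :
    IsUnitalAction (smashAction F act δ) :=
  eq_top_iff.2 fun m _ => by
    obtain ⟨x, hx⟩ := h.exists_fix {m}
    exact Submodule.subset_span ⟨x, m, hx m (by simp)⟩

end Equivariant

/-! ## The smash product as an equivariant module -/

section Regular

variable {k : Type u} [Field k] {H : Type v} [Ring H] [HopfAlgebra k H]

/-- Strong invariance yields `ω * φ(h-) = φ(h'-)` with `h' = ω(S(h₍₁₎)) h₍₂₎`. The formula shows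
which coaction on `Ĥ` induces left convolution. -/
theorem InvariantFunctionals.convolution_translate (F : InvariantFunctionals k H)
    (ω : Module.Dual k H) (h : H) :
    convolution ω (translate F.φ h) = translate F.φ (slice (ω ∘ₗ HopfAlgebra.antipode k)
      (TensorProduct.comm k H H (Coalgebra.comul (R := k) h))) := by
  refine LinearMap.ext fun x => ?_
  change tensorDual ω (translate F.φ h) (Coalgebra.comul (R := k) x) = _
  rw [tensorDual_apply, slice_def, F.strong_invariance]
  generalize Coalgebra.comul (R := k) h = t
  induction t with
  | zero => simp
  | add t t' ht ht' => simp only [map_add, ht, ht', LinearMap.add_apply]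
  | tmul p q => simp [mul_comm]

/-- The element `φ(h-)` of `Ĥ`. -/
noncomputable def InvariantFunctionals.toHat (F : InvariantFunctionals k H) : H →ₗ[k] F.hat :=
  (translate F.φ).codRestrict F.hat F.translate_mem_hat

theorem exists_section_rangeRestrict {U W : Type*} [AddCommGroup U] [Module k U] [AddCommGroup W]
    [Module k W] (f : U →ₗ[k] W) : ∃ σ : LinearMap.range f →ₗ[k] U, ∀ x, f (σ x) = x := by
  obtain ⟨σ, hσ⟩ := f.rangeRestrict.exists_rightInverse_of_surjective f.range_rangeRestrict
  exact ⟨σ, fun x => congrArg Subtype.val (DFunLike.congr_fun hσ x)⟩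

/-- Choosing a linear section avoids having to prove that `h ↦ φ(h-)` is injective. -/
theorem InvariantFunctionals.exists_section (F : InvariantFunctionals k H) :
    ∃ σ : F.hat →ₗ[k] H, ∀ χ, F.toHat (σ χ) = χ := by
  obtain ⟨σ, hσ⟩ := exists_section_rangeRestrict (translate F.φ)
  exact ⟨σ, fun χ => Subtype.ext (hσ χ)⟩

/-- The coaction `φ(h-) ↦ φ(h₍₂₎-) ⊗ S(h₍₁₎)` on `Ĥ`, for which the functionals on `H` act by
left convolution. -/
noncomputable def InvariantFunctionals.hatCoaction (F : InvariantFunctionals k H) :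
    F.hat →ₗ[k] F.hat ⊗[k] H :=
  TensorProduct.map F.toHat (HopfAlgebra.antipode k) ∘ₗ (TensorProduct.comm k H H).toLinearMap ∘ₗ
    Coalgebra.comul ∘ₗ F.exists_section.choose

/-- The slices do not involve the chosen section, and they determine the coaction; so the coaction
is independent of that choice. -/
theorem InvariantFunctionals.slice_hatCoaction (F : InvariantFunctionals k H)
    (ω : Module.Dual k H) (χ : F.hat) : slice ω (F.hatCoaction χ) = F.convHat ω χ := by
  have hχ : F.toHat (F.exists_section.choose χ) = χ := F.exists_section.choose_spec χ
  have h1 : ∀ t : H ⊗[k] H, slice ω (TensorProduct.map F.toHat (HopfAlgebra.antipode k) t) =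
      F.toHat (slice (ω ∘ₗ HopfAlgebra.antipode k) t) := by
    intro t
    induction t with
    | zero => simp
    | add t t' ht ht' => simp only [map_add, ht, ht']
    | tmul p q => simp
  have h2 : F.toHat (slice (ω ∘ₗ HopfAlgebra.antipode k) (TensorProduct.comm k H H
      (Coalgebra.comul (R := k) (F.exists_section.choose χ)))) =
      F.convHat ω (F.toHat (F.exists_section.choose χ)) :=
    Subtype.ext (F.convolution_translate ω _).symm
  rw [hχ] at h2
  rw [← h2, ← h1]
  rfl

theorem convolution_counit_left (χ : Module.Dual k H) :
    convolution (Coalgebra.counit (R := k) (A := H)) χ = χ := by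
  refine LinearMap.ext fun x => ?_
  change LinearMap.mul' k k (TensorProduct.map _ χ (Coalgebra.comul (R := k) x)) = χ x
  have h : ∀ z : H ⊗[k] H, LinearMap.mul' k k (TensorProduct.map (Coalgebra.counit (R := k)) χ z) =
      χ (TensorProduct.lid k H ((Coalgebra.counit (R := k)).rTensor H z)) := by
    intro z
    induction z with
    | zero => simp
    | add z z' hz hz' => simp only [map_add, hz, hz']
    | tmul g h => simp
  rw [h, Coalgebra.rTensor_counit_comul]
  simp

theorem translate_counit (h : H) :
    translate (Coalgebra.counit (R := k) (A := H)) h = Coalgebra.counit (R := k) h •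
      Coalgebra.counit (R := k) (A := H) := by
  ext; simp [translate]

theorem translate_one (ω : Module.Dual k H) : translate ω (1 : H) = ω := by
  ext; simp [translate]

variable {A : Type w} [NonUnitalRing A] [Module k A] [IsScalarTower k A A] [SMulCommClass k A A]
  (α : ComoduleAlgebra k H A) (F : InvariantFunctionals k H)

namespace SmashProduct

/-- The diagonal map `(a ⊗ g) ⊗ (χ ⊗ h) ↦ (a ⊗ χ) ⊗ gh`. -/
noncomputable def diagonal :
    (A ⊗[k] H) ⊗[k] (F.hat ⊗[k] H) →ₗ[k] (A ⊗[k] F.hat) ⊗[k] H :=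
  (LinearMap.mul' k H).lTensor (A ⊗[k] F.hat) ∘ₗ
    (TensorProduct.tensorTensorTensorComm k A H F.hat H).toLinearMap

omit [IsScalarTower k A A] [SMulCommClass k A A] in
@[simp]
theorem diagonal_tmul (a : A) (g h : H) (χ : F.hat) :
    diagonal (A := A) F ((a ⊗ₜ g) ⊗ₜ (χ ⊗ₜ h)) = (a ⊗ₜ χ) ⊗ₜ (g * h) := rfl

/-- The coaction of `H` on `A ⊗ Ĥ`. -/
noncomputable def coaction : A ⊗[k] F.hat →ₗ[k] (A ⊗[k] F.hat) ⊗[k] H :=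
  diagonal F ∘ₗ TensorProduct.map α.coact F.hatCoaction

theorem dualAction_coaction_tmul (ω : Module.Dual k H) (b : A) (χ : F.hat) :
    dualAction (coaction α F) ω (b ⊗ₜ χ) = TensorProduct.map LinearMap.id
      (F.convHat.flip χ ∘ₗ translate ω) (α.coact b) := by
  change slice ω (diagonal F (α.coact b ⊗ₜ F.hatCoaction χ)) = _
  generalize α.coact b = s
  induction s with
  | zero => simp
  | add s s' hs hs' => simp only [map_add, TensorProduct.add_tmul, hs, hs']
  | tmul c h =>
    rw [TensorProduct.map_tmul, LinearMap.comp_apply, LinearMap.flip_apply, ← F.slice_hatCoaction]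
    generalize F.hatCoaction χ = t
    induction t with
    | zero => simp
    | add t t' ht ht' => simp only [map_add, TensorProduct.tmul_add, ht, ht']
    | tmul θ g => simp [translate]

/-- The action of `A` on `A ⊗ Ĥ` by left multiplication. -/
noncomputable def leftMul : A →ₗ[k] A ⊗[k] F.hat →ₗ[k] A ⊗[k] F.hat :=
  LinearMap.rTensorHom F.hat ∘ₗ LinearMap.mul k A

variable {α} in
theorem exists_leftMul_eq (hα : α.HasCoinvariantLocalUnits) (s : Finset (A ⊗[k] F.hat)) :
    ∃ e : A, α.coact e = e ⊗ₜ[k] (1 : H) ∧ ∀ m ∈ s, leftMul F e m = m := by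
  classical
  choose t ht using fun m : A ⊗[k] F.hat => exists_finset_rTensor_eq m
  obtain ⟨e, he, h⟩ := hα (s.biUnion t)
  exact ⟨e, he, fun m hm => ht m (LinearMap.mul k A e) fun x hx =>
    (h x (Finset.mem_biUnion.2 ⟨m, hm, hx⟩)).1⟩

/-- A functional `ω` sends `b ⊗ χ` to `b₍₀₎ ⊗ ω(b₍₁₎-) * χ`; left multiplication by `a` completes
this to the smash product. So the regular module of `A # Ĥ` comes from an equivariant module. -/
theorem smashAction_leftMul : smashAction F (leftMul F) (coaction α F) = mulMap α F := by
  refine TensorProduct.ext' fun a ω => TensorProduct.ext' fun b χ => ?_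
  rw [smashAction_tmul, mulMap_tmul, dualAction_coaction_tmul]
  generalize α.coact b = s
  induction s with
  | zero => simp
  | add s s' hs hs' => simp only [map_add, hs, hs']
  | tmul c h => simp [leftMul]

-- The module law over `Ĥ` is extracted from associativity of the smash product. Since `α(e) = e ⊗
-- 1`, one has `(e ⊗ ω)(e ⊗ χ) = e² ⊗ ω * χ`, and `e` can be chosen to fix all vectors involved.
-- This is where coinvariance of the local units matters.
variable {α} in
theorem isComodule_coaction (hα : α.HasCoinvariantLocalUnits) : IsComodule (coaction α F) := by
  classical
  refine isComodule_of_dualAction F.separatesPoints (fun ω hω χ hχ m => ?_) fun m => ?_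
  · obtain ⟨e, hc, he⟩ := exists_leftMul_eq F hα {dualAction (coaction α F) (convolution ω χ) m,
      dualAction (coaction α F) χ m, dualAction (coaction α F) ω (dualAction (coaction α F) χ m)}
    simp only [Finset.mem_insert, Finset.mem_singleton, forall_eq_or_imp, forall_eq] at he
    have h := mulMap_assoc α F (e ⊗ₜ ⟨ω, hω⟩) (e ⊗ₜ ⟨χ, hχ⟩) m
    rw [mulMap_tmul, hc, TensorProduct.map_tmul, ← smashAction_leftMul] at h
    simp only [smashAction_tmul] at h
    rw [he.2.1, he.2.2] at h
    rw [← h, LinearMap.mul_apply', LinearMap.comp_apply, translate_one]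
    have h2 : leftMul F (e * e) = leftMul F e ∘ₗ leftMul F e :=
      TensorProduct.ext' fun a χ => by simp [leftMul, mul_assoc]
    rw [h2, LinearMap.comp_apply]
    conv_lhs => rw [← he.1, ← he.1]
    rfl
  · induction m with
    | zero => simp
    | add m m' hm hm' => simp only [map_add, hm, hm']
    | tmul b χ =>
      rw [dualAction_coaction_tmul]
      have h : ∀ s : A ⊗[k] H, TensorProduct.map LinearMap.id
          (F.convHat.flip χ ∘ₗ translate (Coalgebra.counit (R := k) (A := H))) s =
          (slice (Coalgebra.counit (R := k) (A := H)) s) ⊗ₜ χ := by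
        intro s
        have hc : F.convHat (Coalgebra.counit (R := k) (A := H)) χ = χ :=
          Subtype.ext (convolution_counit_left _)
        induction s with
        | zero => simp
        | add s s' hs hs' => simp only [map_add, TensorProduct.add_tmul, hs, hs']
        | tmul c h => simp [translate_counit, hc, TensorProduct.smul_tmul]
      rw [h]
      exact congrArg (· ⊗ₜ χ) (α.isComodule.counit b)

variable {α} in
theorem isEquivariantModule (hα : α.HasCoinvariantLocalUnits) :
    IsEquivariantModule α (leftMul F) (coaction α F) where
  isModuleAction x y m := by
    have : leftMul F (x * y) = leftMul F x ∘ₗ leftMul F y :=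
      TensorProduct.ext' fun a χ => by simp [leftMul, mul_assoc]
    rw [this]; rfl
  isComodule := isComodule_coaction F hα
  equivariant a m := by
    have h : ∀ (s s' : A ⊗[k] H) (t : F.hat ⊗[k] H), diagonal F ((s * s') ⊗ₜ t) =
        TensorProduct.map₂ (leftMul F) (LinearMap.mul k H) s (diagonal F (s' ⊗ₜ t)) := by
      intro s s' t
      induction s with
      | zero => simp
      | add s₁ s₂ h₁ h₂ =>
        simp only [add_mul, TensorProduct.add_tmul, map_add, LinearMap.add_apply, h₁, h₂]
      | tmul a g =>
      induction s' with
      | zero => simp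
      | add s₁ s₂ h₁ h₂ => simp only [mul_add, TensorProduct.add_tmul, map_add, h₁, h₂]
      | tmul b h =>
      induction t with
      | zero => simp
      | add t₁ t₂ h₁ h₂ => simp only [TensorProduct.tmul_add, map_add, h₁, h₂]
      | tmul χ l => simp [leftMul, mul_assoc]
    induction m with
    | zero => simp
    | add m m' hm hm' => simp only [map_add, hm, hm']
    | tmul b χ =>
      change diagonal F (α.coact (a * b) ⊗ₜ F.hatCoaction χ) = _
      rw [α.map_mul, h]
      rfl

variable {α} in
theorem hasLocalUnitAction (hα : α.HasCoinvariantLocalUnits) :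
    HasLocalUnitAction F (leftMul F) (coaction α F) :=
  (isEquivariantModule F hα).hasLocalUnitAction F hα <| eq_top_iff.2 fun m _ => by
    obtain ⟨e, -, he⟩ := exists_leftMul_eq F hα {m}
    exact Submodule.subset_span ⟨e, m, he m (by simp)⟩

variable {α} in
theorem isUnitalAction_leftMul (hα : α.HasCoinvariantLocalUnits) :
    IsUnitalAction (leftMul (k := k) (A := A) F) :=
  eq_top_iff.2 fun m _ => by
    obtain ⟨e, -, he⟩ := exists_leftMul_eq F hα {m}
    exact Submodule.subset_span ⟨e, m, he m (by simp)⟩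

variable {α F} in
/-- The smash product has left local units. -/
theorem exists_left_unit (hα : α.HasCoinvariantLocalUnits) (s : Finset (SmashProduct α F)) :
    ∃ e : SmashProduct α F, ∀ x ∈ s, e * x = x := by
  obtain ⟨e, he⟩ := (hasLocalUnitAction F hα).exists_fix s
  rw [smashAction_leftMul] at he
  exact ⟨e, he⟩

-- This is the only instance of equivariant absolute semisimplicity that the construction of the
-- Morita equivalence requires.
variable {α F} in
theorem isAbsolutelySemisimpleAction_mul (hα : α.HasCoinvariantLocalUnits)
    (h : α.IsAbsolutelySemisimple) :
    IsAbsolutelySemisimpleAction (LinearMap.mul k (SmashProduct α F)) := by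
  have h1 := (hasLocalUnitAction F hα).isAbsolutelySemisimpleAction_iff.2
    (h _ _ _ (isEquivariantModule F hα) (isUnitalAction_leftMul F hα))
  rw [smashAction_leftMul] at h1
  exact h1

end SmashProduct

theorem ComoduleAlgebra.isAbsolutelySemisimple_of_smashProduct {α : ComoduleAlgebra k H A}
    {F : InvariantFunctionals k H} (hα : α.HasCoinvariantLocalUnits)
    (h : IsAbsolutelySemisimpleAlgebra k (SmashProduct α F)) : α.IsAbsolutelySemisimple := by
  intro V _ _ act δ hV hu
  have hl := hV.hasLocalUnitAction F hα hu
  exact hl.isAbsolutelySemisimpleAction_iff.1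
    (h V (smashAction F act δ) (hV.isModuleAction_smashAction F) hl.isUnitalAction_smashAction)

end Regular

/-! ## Absolutely simple modules -/

section AbsolutelySimple

variable {k : Type u} [Field k] {D : Type*} [AddCommGroup D] [Module k D]

section BaseChange

variable {V : Type*} [AddCommGroup V] [Module k V] {act : D →ₗ[k] V →ₗ[k] V}
  (K : Type*) [Field K] [Algebra k K]

theorem one_tmul_eq_zero_iff {m : V} : (1 : K) ⊗ₜ[k] m = 0 ↔ m = 0 := by
  refine ⟨fun h => ?_, fun h => by simp [h]⟩
  by_contra hm
  obtain ⟨f, hf, -⟩ := Submodule.exists_le_ker_of_notMem (p := (⊥ : Submodule k V)) (v := m)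
    (by simpa using hm)
  have := congrArg (baseChangeDual K f) h
  rw [baseChangeDual_tmul, map_zero] at this
  simp [hf] at this

-- Simplicity descends because `W ↦ K ⊗ W` preserves invariance and detects whether `W` is `0` or
-- `V`.
variable {K} in
theorem IsSimpleAction.of_baseChange (h : IsSimpleAction (baseChangeAction K act)) :
    IsSimpleAction act := by
  refine ⟨?_, fun W hW => ?_⟩
  · by_contra hcon
    push Not at hcon
    obtain ⟨x, m, hm⟩ := h.1
    have hact : act = 0 := LinearMap.ext fun x => LinearMap.ext (hcon x)
    subst hact
    refine hm ?_
    clear hm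
    induction x with
    | zero => simp
    | add x y hx hy => rw [map_add, LinearMap.add_apply, hx, hy, add_zero]
    | tmul c x => simp [baseChangeAction_tmul_apply]
  · have hX : IsInvariant (baseChangeAction K act) (W.baseChange K) := by
      rw [isInvariant_baseChangeAction_iff]
      intro x m hm
      rw [Submodule.baseChange_eq_span] at hm
      induction hm using Submodule.span_induction with
      | mem m hm =>
        obtain ⟨m, hm, rfl⟩ := hm
        simpa using Submodule.tmul_mem_baseChange_of_mem 1 (hW x m hm)
      | zero => simp
      | add m m' _ _ h h' => rw [map_add]; exact add_mem h h'
      | smul c m _ h => rw [map_smul]; exact Submodule.smul_mem _ _ h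
    refine (h.2 _ hX).imp (fun h0 => ?_) fun h1 => ?_
    · refine (Submodule.eq_bot_iff _).2 fun m hm => (one_tmul_eq_zero_iff (k := k) K).1 ?_
      rw [← Submodule.mem_bot K, ← h0]
      exact Submodule.tmul_mem_baseChange_of_mem 1 hm
    · refine eq_top_iff.2 fun m _ => ?_
      have hker : W.baseChange K ≤ LinearMap.ker (W.mkQ.baseChange K) := by
        rw [Submodule.baseChange_eq_span, Submodule.span_le]
        rintro _ ⟨m, hm, rfl⟩
        simp [(Submodule.Quotient.mk_eq_zero W).2 hm]
      rw [h1] at hker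
      have := hker (x := (1 : K) ⊗ₜ[k] m) trivial
      rw [LinearMap.mem_ker, LinearMap.baseChange_tmul, one_tmul_eq_zero_iff] at this
      simpa using this

/-- An extension field of `k` acting `D`-linearly on `V`, for which `K ⊗ V` is simple,
equals `k`. -/
theorem IsSimpleAction.exists_algebraMap_eq [Module K V] [IsScalarTower k K V]
    (h : IsSimpleAction (baseChangeAction K act))
    (hK : ∀ (c : K) (x : D) (m : V), act x (c • m) = c • act x m) (c : K) :
    ∃ a : k, algebraMap k K a = c := by
  -- The multiplication map `μ` is `D`-linear, so its kernel is `0` or everything. It is not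
  -- everything, since `μ (1 ⊗ v) = v`; and injectivity gives `c ⊗ v = 1 ⊗ cv`, which is impossible
  -- for `c ∉ k`.
  let μ : K ⊗[k] V →ₗ[K] V := LinearMap.liftBaseChange K LinearMap.id
  have hμ : ∀ (c : K) (m : V), μ (c ⊗ₜ m) = c • m := fun c m => by simp [μ]
  obtain ⟨x, v, hv⟩ := h.of_baseChange.1
  have hv0 : v ≠ 0 := fun h0 => hv (by simp [h0])
  have hX : IsInvariant (baseChangeAction K act) (LinearMap.ker μ) := by
    rw [isInvariant_baseChangeAction_iff]
    have hcomm : ∀ x z, μ ((act x).baseChange K z) = act x (μ z) := by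
      intro x z
      induction z with
      | zero => simp
      | add z z' hz hz' => simp only [map_add, hz, hz']
      | tmul c m => rw [LinearMap.baseChange_tmul, hμ, hμ, hK]
    intro x z hz
    rw [LinearMap.mem_ker, hcomm, LinearMap.mem_ker.1 hz, map_zero]
  rcases h.2 _ hX with h0 | h1
  · by_contra hc
    have hc' : c ∉ Submodule.span k {(1 : K)} := fun hmem => by
      obtain ⟨a, ha⟩ := Submodule.mem_span_singleton.1 hmem
      exact hc ⟨a, by rw [← ha, Algebra.smul_def, mul_one]⟩
    obtain ⟨f, hf, hker⟩ := Submodule.exists_le_ker_of_notMem hc'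
    have hf1 : f 1 = 0 := hker (Submodule.mem_span_singleton_self _)
    have hmem : c ⊗ₜ[k] v - 1 ⊗ₜ[k] (c • v) ∈ LinearMap.ker μ := by
      rw [LinearMap.mem_ker, map_sub, hμ, hμ, one_smul, sub_self]
    rw [h0, Submodule.mem_bot] at hmem
    have := congrArg (fun z => TensorProduct.lid k V (f.rTensor V z)) hmem
    simp [hf1, hf, hv0] at this
  · refine absurd ?_ hv0
    have : (1 : K) ⊗ₜ[k] v ∈ LinearMap.ker μ := h1 ▸ trivial
    rwa [LinearMap.mem_ker, hμ, one_smul] at this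

/-- A module for which there are sufficiently many operators of rank one is absolutely simple. -/
theorem isSimpleAction_baseChange_of_rankOne {w₀ : V} (hw₀ : w₀ ≠ 0)
    (h : ∀ m : V, m ≠ 0 → ∃ f : Module.Dual k V, f m ≠ 0 ∧
      ∀ u : V, ∃ d : D, ∀ m' : V, act d m' = f m' • u) :
    IsSimpleAction (baseChangeAction K act) := by
  refine ⟨?_, fun X hX => ?_⟩
  · obtain ⟨f, hf, hd⟩ := h w₀ hw₀
    obtain ⟨d, hd⟩ := hd w₀
    refine ⟨1 ⊗ₜ d, 1 ⊗ₜ w₀, ?_⟩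
    rw [baseChangeAction_tmul, mul_one, hd, Ne, one_tmul_eq_zero_iff]
    exact smul_ne_zero hf hw₀
  · refine or_iff_not_imp_left.2 fun hne => ?_
    obtain ⟨x, hxX, hx0⟩ := X.ne_bot_iff.1 hne
    -- Expand `x` in a basis of `K` over `k`. A functional that is non-zero on one non-zero
    -- coefficient has a `K`-linear extension that is non-zero on `x`.
    have hf : ∃ f : Module.Dual k V, baseChangeDual K f x ≠ 0 ∧
        ∀ u : V, ∃ d : D, ∀ m' : V, act d m' = f m' • u := by
      let b := Module.Basis.ofVectorSpace k K
      obtain ⟨c, rfl⟩ := TensorProduct.eq_repr_basis_left b x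
      obtain ⟨i, hi⟩ : ∃ i, c i ≠ 0 := by
        by_contra hcon
        push Not at hcon
        exact hx0 (by simp [show c = 0 from Finsupp.ext hcon])
      obtain ⟨f, hf, hd⟩ := h (c i) hi
      refine ⟨f, fun h0 => hf ?_, hd⟩
      have hsl : ∀ z : K ⊗[k] V, baseChangeDual K f z = slice f z := by
        intro z
        induction z with
        | zero => simp
        | add z z' hz hz' => simp only [map_add, hz, hz']
        | tmul x h => simp
      rw [hsl, slice_basis_sum] at h0
      simpa using DFunLike.congr_fun (b.linearIndependent (h0.trans (map_zero _).symm)) i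
    obtain ⟨f, hfx, hd⟩ := hf
    have hu : ∀ u : V, (1 : K) ⊗ₜ[k] u ∈ X := fun u => by
      obtain ⟨d, hd⟩ := hd u
      have hdx : ∀ z : K ⊗[k] V, (act d).baseChange K z = baseChangeDual K f z • (1 ⊗ₜ u) := by
        intro z
        induction z with
        | zero => simp
        | add z z' hz hz' => simp only [map_add, hz, hz', add_smul]
        | tmul x m => simp [hd, TensorProduct.smul_tmul']
      have := (isInvariant_baseChangeAction_iff K act X).1 hX d x hxX
      rw [hdx] at this
      simpa [smul_smul, inv_mul_cancel₀ hfx] using X.smul_mem (baseChangeDual K f x)⁻¹ this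
    refine eq_top_iff.2 fun z _ => ?_
    induction z with
    | zero => exact X.zero_mem
    | add z z' hz hz' => exact X.add_mem (hz trivial) (hz' trivial)
    | tmul c m => simpa [TensorProduct.smul_tmul'] using X.smul_mem c (hu m)

end BaseChange

/-- Take `K = k`, lifted to the universe over which `K` ranges. -/
theorem IsAbsolutelySimpleAction.isSimpleAction {V : Type v} [AddCommGroup V] [Module k V]
    {act : D →ₗ[k] V →ₗ[k] V} (h : IsAbsolutelySimpleAction act) : IsSimpleAction act :=
  (h (ULift.{max u v} k)).of_baseChange

section Schur

variable {V : Type*} [AddCommGroup V] [Module k V] {act : D →ₗ[k] V →ₗ[k] V}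
  {V' : Type*} [AddCommGroup V'] [Module k V'] {act' : D →ₗ[k] V' →ₗ[k] V'}

/-- Schur's lemma. -/
theorem IsSimpleAction.bijective (h : IsSimpleAction act) (h' : IsSimpleAction act')
    {f : V →ₗ[k] V'} (hf : ∀ x m, f (act x m) = act' x (f m)) (hne : f ≠ 0) :
    Function.Bijective f := by
  constructor
  · rw [← LinearMap.ker_eq_bot]
    refine (h.2 (LinearMap.ker f) fun x m hm => ?_).resolve_right fun ht => hne ?_
    · rw [LinearMap.mem_ker, hf, LinearMap.mem_ker.1 hm, map_zero]
    · exact LinearMap.ker_eq_top.1 ht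
  · rw [← LinearMap.range_eq_top]
    refine (h'.2 (LinearMap.range f) ?_).resolve_left fun ht => hne ?_
    · rintro x _ ⟨m, rfl⟩
      exact ⟨act x m, hf x m⟩
    · exact LinearMap.range_eq_bot.1 ht

end Schur

/-- The endomorphisms of an absolutely simple module are scalars. -/
theorem IsAbsolutelySimpleAction.exists_eq_smul {V : Type (max u v)} [AddCommGroup V] [Module k V]
    {act : D →ₗ[k] V →ₗ[k] V} (h : IsAbsolutelySimpleAction act) (f : V →ₗ[k] V)
    (hf : ∀ x m, f (act x m) = act x (f m)) : ∃ c : k, ∀ m, f m = c • m := by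
  -- Let `Z` be the commutant of `f` and `D`. It contains `f`, which is central in it by
  -- construction. The centre `L` of `Z` is commutative, and by Schur's lemma it is a field; it lies
  -- in the universe admitted for extension fields, so `K = L` is allowed.
  let G : Set (Module.End k V) := insert f (Set.range act)
  let Z := Subalgebra.centralizer k G
  let L := Subalgebra.center k Z
  have hsimple := h.isSimpleAction
  have hlin : ∀ (z : Z) (x : D) (m : V), (z : Module.End k V) (act x m) = act x ((z : Module.End k V) m) :=
    fun z x m => (DFunLike.congr_fun (z.2 (act x) (Set.mem_insert_of_mem _ ⟨x, rfl⟩)) m).symm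
  have hfield : IsField L := by
    refine ⟨⟨0, 1, fun h01 => ?_⟩, mul_comm, fun {a} ha => ?_⟩
    · obtain ⟨x, m, hm⟩ := hsimple.1
      have h1 : (0 : Module.End k V) = 1 := congrArg (fun z : L => ((z : Z) : Module.End k V)) h01
      exact hm (by simpa using (DFunLike.congr_fun h1 (act x m)).symm)
    · have ha' : ((a : Z) : Module.End k V) ≠ 0 := fun h0 => ha (Subtype.ext (Subtype.ext h0))
      have hbij := hsimple.bijective hsimple (hlin a) ha'
      let e := LinearEquiv.ofBijective _ hbij
      have he1 : ((a : Z) : Module.End k V) * e.symm.toLinearMap = 1 :=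
        LinearMap.ext fun m => e.apply_symm_apply m
      have he2 : e.symm.toLinearMap * ((a : Z) : Module.End k V) = 1 :=
        LinearMap.ext fun m => e.symm_apply_apply m
      have hcomm : ∀ g : Module.End k V, g * (a : Z) = (a : Z) * g →
          g * e.symm.toLinearMap = e.symm.toLinearMap * g := fun g hg => by
        calc g * e.symm.toLinearMap
            = e.symm.toLinearMap * (a : Z) * g * e.symm.toLinearMap := by rw [he2, one_mul]
          _ = e.symm.toLinearMap * (g * (a : Z)) * e.symm.toLinearMap := by rw [hg, mul_assoc _ _ g]
          _ = e.symm.toLinearMap * g * ((a : Z) * e.symm.toLinearMap) := by simp only [mul_assoc]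
          _ = _ := by rw [he1, mul_one]
      let b : Z := ⟨e.symm.toLinearMap, fun g hg => hcomm g ((a : Z).2 g hg)⟩
      refine ⟨⟨b, Subalgebra.mem_center_iff.2 fun z => Subtype.ext (hcomm z ?_)⟩,
        Subtype.ext (Subtype.ext he1)⟩
      exact congrArg Subtype.val (Subalgebra.mem_center_iff.1 a.2 z)
  let _ : Field L := hfield.toField
  have hfZ : f ∈ Z := by
    rintro g (rfl | ⟨x, rfl⟩)
    · rfl
    · exact LinearMap.ext fun m => (hf x m).symm
  have hfL : (⟨f, hfZ⟩ : Z) ∈ L := Subalgebra.mem_center_iff.2 fun z =>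
    Subtype.ext (z.2 f (Set.mem_insert _ _)).symm
  have : IsScalarTower k L V := ⟨fun _ _ _ => rfl⟩
  obtain ⟨c, hc⟩ := (h L).exists_algebraMap_eq L (fun c x m => (hlin c x m).symm) ⟨⟨f, hfZ⟩, hfL⟩
  refine ⟨c, fun m => ?_⟩
  have := congrArg (fun z : L => ((z : Z) : Module.End k V) m) hc
  exact this.symm

end AbsolutelySimple

/-! ## Decomposing modules that are sums of simple submodules -/

section Decomposition

variable {k : Type u} [Field k] {D : Type*} [AddCommGroup D] [Module k D]
  {V : Type v} [AddCommGroup V] [Module k V] (act : D →ₗ[k] V →ₗ[k] V)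

/-- An invariant subspace as a submodule over the algebra of operators generated by `D`. -/
noncomputable def IsInvariant.toSubmodule {act : D →ₗ[k] V →ₗ[k] V} {W : Submodule k V}
    (hW : IsInvariant act W) : Submodule (Algebra.adjoin k (Set.range act)) V where
  __ := W
  smul_mem' b m hm := by
    obtain ⟨b, hb⟩ := b
    change b m ∈ W
    induction hb using Algebra.adjoin_induction generalizing m with
    | mem b hb => obtain ⟨x, rfl⟩ := hb; exact hW x m hm
    | algebraMap c => exact W.smul_mem c hm
    | add b b' _ _ h h' => exact W.add_mem (h m hm) (h' m hm)
    | mul b b' _ _ h h' => exact h _ (h' m hm)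

@[simp]
theorem IsInvariant.mem_toSubmodule {act : D →ₗ[k] V →ₗ[k] V} {W : Submodule k V}
    (hW : IsInvariant act W) (m : V) : m ∈ hW.toSubmodule ↔ m ∈ W := Iff.rfl

theorem isInvariant_restrictScalars (N : Submodule (Algebra.adjoin k (Set.range act)) V) :
    IsInvariant act (N.restrictScalars k) := fun x _ hm =>
  N.smul_mem ⟨act x, Algebra.subset_adjoin ⟨x, rfl⟩⟩ hm

/-- `W` is minimal among the non-zero invariant subspaces. -/
def IsMinimalInvariant (W : Submodule k V) : Prop :=
  IsInvariant act W ∧ W ≠ ⊥ ∧ ∀ W' ≤ W, IsInvariant act W' → W' = ⊥ ∨ W' = W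

theorem IsInvariant.isAtom_toSubmodule_iff {act : D →ₗ[k] V →ₗ[k] V} {W : Submodule k V}
    (hW : IsInvariant act W) : IsAtom hW.toSubmodule ↔ IsMinimalInvariant act W := by
  constructor
  · refine fun h => ⟨hW, fun h0 => h.1 ?_, fun W' hle hW' => ?_⟩
    · refine (Submodule.eq_bot_iff _).2 fun m hm => ?_
      rwa [hW.mem_toSubmodule, h0, Submodule.mem_bot] at hm
    · have hle' : hW'.toSubmodule ≤ hW.toSubmodule := fun m hm => hle hm
      refine (h.le_iff.1 hle').imp (fun h0 => ?_) fun h1 => ?_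
      · exact (Submodule.eq_bot_iff _).2 fun m hm => (Submodule.eq_bot_iff _).1 h0 m hm
      · exact le_antisymm hle fun m hm => h1.ge hm
  · rintro ⟨-, h0, h⟩
    refine ⟨fun hb => h0 ((Submodule.eq_bot_iff _).2 fun m hm => (Submodule.eq_bot_iff _).1 hb m hm),
      fun N hN => ?_⟩
    rcases h (N.restrictScalars k) (fun m hm => hN.le hm) (isInvariant_restrictScalars act N) with
      h1 | h1
    · exact (Submodule.eq_bot_iff _).2 fun m hm => (Submodule.eq_bot_iff _).1 h1 m hm
    · exact absurd (fun m hm => h1.ge hm) hN.not_ge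

/-- Invariant subspaces are the submodules over the unital algebra of operators generated by `D`. In
their lattice a supremum of atoms equal to the top can be refined to an independent one. -/
theorem exists_isInternal_isMinimalInvariant
    (h : ∀ m : V, m ∈ ⨆ W : {W : Submodule k V // IsMinimalInvariant act W}, (W : Submodule k V)) :
    ∃ (ι : Type v) (W : ι → Submodule k V), (∀ i, IsMinimalInvariant act (W i)) ∧
      ∀ [DecidableEq ι], DirectSum.IsInternal W := by
  have htop : sSup {N : Submodule (Algebra.adjoin k (Set.range act)) V | IsAtom N} = ⊤ := by
    refine eq_top_iff.2 fun m _ => ?_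
    have hle : (⨆ W : {W : Submodule k V // IsMinimalInvariant act W}, (W : Submodule k V)) ≤
        (sSup {N : Submodule (Algebra.adjoin k (Set.range act)) V | IsAtom N}).restrictScalars k :=
      iSup_le fun W m hm => by
        have hat := (W.2.1.isAtom_toSubmodule_iff).2 W.2
        exact (le_sSup (show W.2.1.toSubmodule ∈ {N | IsAtom N} from hat)) hm
    exact hle (h m)
  obtain ⟨s, hs, hs', hat⟩ := exists_sSupIndep_of_sSup_atoms_eq_top htop
  refine ⟨s, fun N => N.1.restrictScalars k, fun N => ?_, ?_⟩
  · exact ((isInvariant_restrictScalars act N.1).isAtom_toSubmodule_iff).1 (hat N.2)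
  · intro _
    exact DirectSum.isInternal_submodule_of_iSupIndep_of_iSup_eq_top
      (A := fun N : s => N.1) ((sSupIndep_iff _).1 hs) (by rw [← hs', sSup_eq_iSup'])

end Decomposition

/-! ## Algebras spanned by matrix units -/

section RankOne

variable {k : Type u} [Field k] {D : Type w} [NonUnitalRing D] [Module k D]
  [IsScalarTower k D D] [SMulCommClass k D D]

/-- An algebra with left local units is absolutely semisimple if it is spanned by elements
`[x, q]_i` that multiply like operators of rank one. -/
theorem isAbsolutelySemisimpleAlgebra_of_rankOne (hD : ∀ s : Finset D, ∃ e : D, ∀ x ∈ s, e * x = x)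
    {I X Q : Type*} [AddCommGroup X] [Module k X] [AddCommGroup Q] [Module k Q]
    (br : I → X →ₗ[k] Q →ₗ[k] D) (pair : I → Q →ₗ[k] X →ₗ[k] k)
    (hmul : ∀ i x q y p, br i x q * br i y p = pair i q y • br i x p)
    (hmul' : ∀ i j, i ≠ j → ∀ x q y p, br i x q * br j y p = 0)
    (hspan : ∀ d : D, d ∈ Submodule.span k {d | ∃ i x q, br i x q = d}) :
    IsAbsolutelySemisimpleAlgebra k D := by
  classical
  intro V _ _ act hact hu
  -- If `y` is in the radical of the pairing, then all of `D` annihilates `[y, p]_i` from the left;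
  -- but a left local unit fixes this element.
  have hpair : ∀ i y, (∀ q, pair i q y = 0) → ∀ p, br i y p = 0 := by
    intro i y hy p
    have hz : ∀ d : D, d * br i y p = 0 := by
      intro d
      induction hspan d using Submodule.span_induction with
      | mem d hd =>
        obtain ⟨j, x, q, rfl⟩ := hd
        by_cases hji : j = i
        · subst hji; rw [hmul, hy, zero_smul]
        · exact hmul' _ _ hji _ _ _ _
      | zero => exact zero_mul _
      | add d d' _ _ h h' => rw [add_mul, h, h', add_zero]
      | smul c d _ h => rw [smul_mul_assoc, h, smul_zero]
    obtain ⟨e, he⟩ := hD {br i y p}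
    rw [← he _ (Finset.mem_singleton_self _), hz]
  have hfix : ∀ m : V, ∃ e : D, act e m = m := fun m => by
    obtain ⟨t, ht⟩ := hu.exists_fix hact {m}
    obtain ⟨e, he⟩ := hD t
    exact ⟨e, ht e he m (Finset.mem_singleton_self _)⟩
  -- For fixed `i, p, m` the vectors `[x, p]_i m` form a submodule on which `[x, q]_i` acts with
  -- rank at most one. These ranges are the candidates for the simple summands.
  let G : I → Q → V → X →ₗ[k] V := fun i p m => act.flip m ∘ₗ (br i).flip p
  have hG : ∀ i p m x, G i p m x = act (br i x p) m := fun _ _ _ _ => rfl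
  have hGact : ∀ i x q y p m, act (br i x q) (G i p m y) = pair i q y • G i p m x := by
    intro i x q y p m
    rw [hG, hG, ← hact, hmul, map_smul, LinearMap.smul_apply]
  have hGinv : ∀ i p m, IsInvariant act (LinearMap.range (G i p m)) := by
    rintro i p m d _ ⟨y, rfl⟩
    induction hspan d using Submodule.span_induction with
    | mem d hd =>
      obtain ⟨j, x, q, rfl⟩ := hd
      by_cases hji : j = i
      · subst hji
        rw [hGact]
        exact ⟨_, map_smul _ _ _⟩
      · rw [hG, ← hact, hmul' _ _ hji, map_zero]
        exact zero_mem _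
    | zero => rw [map_zero]; exact zero_mem _
    | add d d' _ _ h h' => rw [map_add]; exact add_mem h h'
    | smul c d _ h => rw [map_smul]; exact Submodule.smul_mem _ _ h
  have hGsimple : ∀ i p m, LinearMap.range (G i p m) ≠ ⊥ → ∀ (K : Type (max u w)) [Field K]
      [Algebra k K], IsSimpleAction (baseChangeAction K (restrictAction act _ (hGinv i p m))) := by
    intro i p m hne K _ _
    obtain ⟨σ, hσ⟩ := exists_section_rangeRestrict (G i p m)
    obtain ⟨w, hw, hw0⟩ := (Submodule.ne_bot_iff _).1 hne
    refine isSimpleAction_baseChange_of_rankOne K (w₀ := ⟨w, hw⟩) (fun h => hw0 (by simpa using h))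
      fun z hz => ?_
    -- A preimage pairing to zero with every `q` would be mapped to zero by `G`, so a non-zero `z`
    -- is detected by some `q`.
    obtain ⟨q, hq⟩ : ∃ q, pair i q (σ z) ≠ 0 := by
      by_contra hcon
      push Not at hcon
      refine hz (Subtype.ext ?_)
      rw [← hσ, hG, hpair i _ hcon, map_zero]
      rfl
    refine ⟨pair i q ∘ₗ σ, hq, fun z' => ⟨br i (σ z') q, fun z'' => Subtype.ext ?_⟩⟩
    change act (br i (σ z') q) z'' = pair i q (σ z'') • (z' : V)
    rw [← hσ z'', hGact, hσ]
  have hGmin : ∀ i p m, LinearMap.range (G i p m) ≠ ⊥ →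
      IsMinimalInvariant act (LinearMap.range (G i p m)) := by
    refine fun i p m hne => ⟨hGinv i p m, hne, fun W' hle hW' => ?_⟩
    have hs := (hGsimple i p m hne (ULift.{max u w} k)).of_baseChange
    refine (hs.2 (W'.comap (Submodule.subtype _)) fun x z hz => hW' x _ hz).imp (fun h0 => ?_)
      fun h1 => ?_
    · refine (Submodule.eq_bot_iff _).2 fun z hz => ?_
      simpa using (Submodule.eq_bot_iff _).1 h0 ⟨z, hle hz⟩ hz
    · exact le_antisymm hle fun z hz => h1.ge (x := ⟨z, hz⟩) trivial
  have hmem : ∀ (m : V) (S : Submodule k V), (∀ i p, LinearMap.range (G i p m) ≤ S) → m ∈ S := by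
    intro m S hS
    obtain ⟨e, he⟩ := hfix m
    rw [← he]
    clear he
    induction hspan e using Submodule.span_induction with
    | mem d hd =>
      obtain ⟨j, x, q, rfl⟩ := hd
      exact hS j q ⟨x, rfl⟩
    | zero => rw [map_zero]; exact zero_mem _
    | add d d' _ _ h h' => rw [map_add]; exact add_mem h h'
    | smul c d _ h => rw [map_smul]; exact Submodule.smul_mem _ _ h
  -- The refinement to a direct sum returns unspecified minimal submodules, so each of these has to
  -- be recognised as one of the ranges.
  have hmin : ∀ W, IsMinimalInvariant act W → ∃ i p m, W = LinearMap.range (G i p m) := by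
    intro W hW
    obtain ⟨m, hmW, hm0⟩ := (Submodule.ne_bot_iff _).1 hW.2.1
    obtain ⟨i, p, hip⟩ : ∃ i p, LinearMap.range (G i p m) ≠ ⊥ := by
      by_contra hcon
      push Not at hcon
      exact hm0 (by simpa using hmem m ⊥ fun i p => (hcon i p).le)
    refine ⟨i, p, m, ((hW.2.2 _ ?_ (hGinv i p m)).resolve_left hip).symm⟩
    rintro _ ⟨x, rfl⟩
    exact hW.1 _ _ hmW
  obtain ⟨ι, W, hW, hint⟩ := exists_isInternal_isMinimalInvariant act fun m => by
    refine hmem m _ fun i p => ?_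
    by_cases hip : LinearMap.range (G i p m) = ⊥
    · rw [hip]; exact bot_le
    · exact le_iSup (fun W : {W : Submodule k V // IsMinimalInvariant act W} => (W : Submodule k V))
        ⟨_, hGmin i p m hip⟩
  have hsimple : ∀ W (hW : IsMinimalInvariant act W),
      IsAbsolutelySimpleAction (restrictAction act W hW.1) := by
    intro W hW
    obtain ⟨i, p, m, rfl⟩ := hmin W hW
    exact hGsimple i p m hW.2.1
  exact ⟨ι, W, fun i => (hW i).1, hint, fun j => hsimple _ (hW j)⟩

end RankOne

/-! ### Matrix units from a Morita equivalence with `k_I` -/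

section Morita

variable {k : Type u} [Field k]

theorem MoritaContext.IsStrict.mem_span_mul {C : MoritaContext.{u, v} k} (hC : C.IsStrict)
    (i j : Fin 2) (d : C.A i i) :
    d ∈ Submodule.span k {d | ∃ (x : C.A i j) (y : C.A j i), C.mul x y = d} := by
  obtain ⟨t, rfl⟩ := (hC i j).2 d
  obtain ⟨t, rfl⟩ := Submodule.mkQ_surjective _ t
  change TensorProduct.lift C.mul t ∈ _
  induction t with
  | zero => rw [map_zero]; exact zero_mem _
  | add t t' h h' => rw [map_add]; exact add_mem h h'
  | tmul x y => exact Submodule.subset_span ⟨x, y, rfl⟩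

open Classical in
theorem single_mul_mul_single {I : Type*} (i j : I) (g : I →₀ k) :
    Finsupp.single i 1 * (g * Finsupp.single j 1) =
      if i = j then g i • Finsupp.single i (1 : k) else 0 := by
  ext l
  split_ifs with h
  · subst h
    by_cases hl : i = l <;> simp [Finsupp.mul_apply, hl]
  · by_cases hl : i = l
    · subst hl; simp [Finsupp.mul_apply, Ne.symm h]
    · simp [Finsupp.mul_apply, hl]

/-- Let `ε_i` be the image of the `i`-th idempotent of `k_I` and `[x, q]_i = x ε_i q`. The factor
`ε_i (q y) ε_j` in the middle of a product is `0` for `i ≠ j` and the value of `q y` at `i` times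
`ε_i` for `i = j`. -/
theorem isAbsolutelySemisimpleAlgebra_of_isMoritaEquivalent {D : Type w} [NonUnitalRing D]
    [Module k D] [IsScalarTower k D D] [SMulCommClass k D D]
    (hD : ∀ s : Finset D, ∃ e : D, ∀ x ∈ s, e * x = x) {I : Type v}
    (h : IsMoritaEquivalent k D (I →₀ k)) : IsAbsolutelySemisimpleAlgebra k D := by
  obtain ⟨C, hC, ⟨e, he⟩, f, hf⟩ := h
  let ε : I → C.A 1 1 := fun i => f (Finsupp.single i 1)
  let br : I → C.A 0 1 →ₗ[k] C.A 1 0 →ₗ[k] D := fun i =>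
    (C.mul.compl₁₂ (C.mul.flip (ε i)) LinearMap.id).compr₂ e.symm.toLinearMap
  let pair : I → C.A 1 0 →ₗ[k] C.A 0 1 →ₗ[k] k := fun i =>
    C.mul.compr₂ (Finsupp.lapply i ∘ₗ f.symm.toLinearMap)
  have hbr : ∀ i x q, e (br i x q) = C.mul (C.mul x (ε i)) q := fun i x q =>
    e.apply_symm_apply _
  have hmid : ∀ (i j : I) (q : C.A 1 0) (y : C.A 0 1),
      C.mul (ε i) (C.mul (C.mul q y) (ε j)) = f (Finsupp.single i 1 *
        (f.symm (C.mul q y) * Finsupp.single j 1)) := fun i j q y => by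
    rw [hf, hf, f.apply_symm_apply]
  have hprod : ∀ i j x q y p, e (br i x q * br j y p) =
      C.mul (C.mul x (C.mul (ε i) (C.mul (C.mul q y) (ε j)))) p := fun i j x q y p => by
    rw [he, hbr, hbr]; simp only [C.assoc]
  refine isAbsolutelySemisimpleAlgebra_of_rankOne hD br pair (fun i x q y p => e.injective ?_)
    (fun i j hij x q y p => e.injective ?_) fun d => ?_
  · rw [hprod, hmid, single_mul_mul_single, if_pos rfl, map_smul, map_smul, map_smul,
      LinearMap.smul_apply, map_smul, hbr]
    rfl
  · rw [hprod, hmid, single_mul_mul_single, if_neg hij, map_zero, map_zero, map_zero,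
      LinearMap.zero_apply, map_zero]
  · let S : Submodule k (C.A 0 0) :=
      (Submodule.span k {d | ∃ i x q, br i x q = d}).comap e.symm.toLinearMap
    have hgen : ∀ (x : C.A 0 1) (q : C.A 1 0) (g : I →₀ k), C.mul (C.mul x (f g)) q ∈ S := by
      intro x q g
      induction g using Finsupp.induction_linear with
      | zero => simp
      | add g g' h h' =>
        rw [map_add, map_add, map_add, LinearMap.add_apply]
        exact add_mem h h'
      | single i c =>
        rw [← mul_one c, ← smul_eq_mul, ← Finsupp.smul_single, map_smul, map_smul, map_smul,
          LinearMap.smul_apply]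
        exact S.smul_mem c (Submodule.subset_span ⟨i, x, q, rfl⟩)
    -- A product `(x q)(y p)` equals `x (q y) p`, where `q y` corresponds to a finitely supported
    -- function, a combination of the idempotents.
    have hmulS : ∀ a b : C.A 0 0, C.mul a b ∈ S := by
      intro a b
      induction hC.mem_span_mul 0 1 a using Submodule.span_induction with
      | zero => rw [map_zero]; exact zero_mem _
      | add a a' _ _ h h' => rw [map_add]; exact add_mem h h'
      | smul c a _ h => rw [map_smul]; exact S.smul_mem c h
      | mem a ha =>
      obtain ⟨x, q, rfl⟩ := ha
      induction hC.mem_span_mul 0 1 b using Submodule.span_induction with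
      | zero => rw [map_zero]; exact zero_mem _
      | add a a' _ _ h h' => rw [map_add]; exact add_mem h h'
      | smul c a _ h => rw [map_smul]; exact S.smul_mem c h
      | mem b hb =>
      obtain ⟨y, p, rfl⟩ := hb
      have := hgen x p (f.symm (C.mul q y))
      rw [f.apply_symm_apply] at this
      simpa only [C.assoc] using this
    have hS : ∀ a : C.A 0 0, a ∈ S := by
      intro a
      refine Submodule.span_le.2 ?_ (hC.mem_span_mul 0 0 a)
      rintro _ ⟨a, b, rfl⟩
      exact hmulS a b
    simpa [S] using hS (e d)

end Morita

/-! ## Constructing strict Morita contexts -/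

section Strict

variable {k : Type u} [Field k]

/-- A Morita context is strict if its multiplication maps are surjective and there are left local
units. -/
theorem MoritaContext.isStrict_of_local_units {C : MoritaContext.{u, v} k}
    (hs : ∀ (i j : Fin 2) (a : C.A i i),
      a ∈ Submodule.span k {d | ∃ (x : C.A i j) (y : C.A j i), C.mul x y = d})
    (hu : ∀ (i j : Fin 2) (s : Finset (C.A i j)), ∃ a : C.A i i, ∀ x ∈ s, C.mul a x = x) :
    C.IsStrict := by
  refine fun i j => ⟨(injective_iff_map_eq_zero _).2 fun t ht => ?_, fun a => ?_⟩
  · obtain ⟨t, rfl⟩ := Submodule.mkQ_surjective _ t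
    change TensorProduct.lift (C.mul (i := i) (j := j) (l := i)) t = 0 at ht
    -- Over `A j j` one has `(p q) x ⊗ y = p ⊗ q (x y)`. So products `p q` annihilate the kernel of
    -- multiplication; they span `A i i`, which contains an element fixing `t`.
    have h1 : ∀ (p : C.A i j) (q : C.A j i) (z : C.A i j ⊗[k] C.A j i),
        (C.balancingRelations i j).mkQ ((C.mul (C.mul p q)).rTensor _ z) =
        (C.balancingRelations i j).mkQ (p ⊗ₜ C.mul q (TensorProduct.lift C.mul z)) := by
      intro p q z
      induction z with
      | zero => simp
      | add z z' hz hz' => simp only [map_add, TensorProduct.tmul_add, hz, hz']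
      | tmul x y =>
        refine (Submodule.Quotient.eq _).2 (Submodule.subset_span ⟨p, C.mul q x, y, ?_⟩)
        simp [C.assoc]
    have h2 : ∀ a : C.A i i, (C.balancingRelations i j).mkQ ((C.mul a).rTensor _ t) = 0 := by
      intro a
      induction hs i j a using Submodule.span_induction with
      | mem a ha =>
        obtain ⟨p, q, rfl⟩ := ha
        rw [h1, ht, map_zero, TensorProduct.tmul_zero, map_zero]
      | zero => simp
      | add a b _ _ h h' => rw [map_add, LinearMap.rTensor_add, LinearMap.add_apply, map_add, h, h',
          add_zero]
      | smul c a _ h => rw [map_smul, LinearMap.rTensor_smul, LinearMap.smul_apply, map_smul, h,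
          smul_zero]
    obtain ⟨s, hs⟩ := exists_finset_rTensor_eq t
    obtain ⟨a, ha⟩ := hu i j s
    rw [← h2 a, hs _ ha]
  · change a ∈ LinearMap.range (C.balancedMul i j)
    refine Submodule.span_le.2 ?_ (hs i j a)
    rintro _ ⟨x, y, rfl⟩
    exact ⟨(C.balancingRelations i j).mkQ (x ⊗ₜ y), rfl⟩

/-- The Morita context formed by subspaces of an algebra that are closed under the reversed
multiplication. -/
noncomputable def MoritaContext.ofSubmodules {R : Type v} [Ring R] [Algebra k R]
    (A : Fin 2 → Fin 2 → Submodule k R) (hA : ∀ i j l, A j l * A i j ≤ A i l) :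
    MoritaContext.{u, v} k where
  A i j := A i j
  -- The order is reversed so that assigning to `d` its right multiplication becomes multiplicative.
  mul {i j l} := LinearMap.mk₂ k (fun x y => ⟨y * x, hA i j l (Submodule.mul_mem_mul y.2 x.2)⟩)
    (fun _ _ _ => by ext; simp [mul_add]) (fun _ _ _ => by ext; simp)
    (fun _ _ _ => by ext; simp [add_mul]) (fun _ _ _ => by ext; simp)
  assoc x y z := Subtype.ext (mul_assoc _ _ _).symm

theorem MoritaContext.isStrict_ofSubmodules {R : Type v} [Ring R] [Algebra k R]
    (A : Fin 2 → Fin 2 → Submodule k R) (hA : ∀ i j l, A j l * A i j ≤ A i l)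
    (hs : ∀ i j, A i i ≤ A j i * A i j)
    (hu : ∀ (i j : Fin 2) (s : Finset R), (∀ x ∈ s, x ∈ A i j) → ∃ a ∈ A i i, ∀ x ∈ s, x * a = x) :
    (ofSubmodules A hA).IsStrict := by
  classical
  refine isStrict_of_local_units (fun i j a => ?_) fun i j s => ?_
  · let S : Submodule k (A i i) := Submodule.span k
      {d | ∃ (x : (ofSubmodules A hA).A i j) (y : (ofSubmodules A hA).A j i),
        (ofSubmodules A hA).mul x y = d}
    have h : A j i * A i j ≤ S.map (A i i).subtype := by
      refine Submodule.mul_le.2 fun y hy x hx => ?_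
      exact ⟨⟨y * x, hA i j i (Submodule.mul_mem_mul hy hx)⟩,
        Submodule.subset_span ⟨⟨x, hx⟩, ⟨y, hy⟩, rfl⟩, rfl⟩
    obtain ⟨b, hb, hba⟩ := h (hs i j (Subtype.property (p := (· ∈ A i i)) a))
    exact (Subtype.ext hba : b = a) ▸ hb
  · obtain ⟨a, ha, h⟩ := hu i j (s.image (Subtype.val : A i j → R)) fun x hx => by
      obtain ⟨y, -, rfl⟩ := Finset.mem_image.1 hx
      exact y.2
    exact ⟨⟨a, ha⟩, fun x hx => Subtype.ext (h _ (Finset.mem_image_of_mem _ hx))⟩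

end Strict

/-! ### A Morita context inside the endomorphisms of the left module `D` -/

section Endomorphisms

variable {k : Type u} [Field k] {D : Type w} [NonUnitalRing D] [Module k D]
  [IsScalarTower k D D] [SMulCommClass k D D]

variable (k D) in
/-- The endomorphisms of the left `D`-module `D`. -/
def leftLinearEnd : Submodule k (Module.End k D) where
  carrier := {f | ∀ x y, f (x * y) = x * f y}
  add_mem' hf hg x y := by simp [hf x y, hg x y, mul_add]
  zero_mem' x y := by simp
  smul_mem' c f hf x y := by simp [hf x y, mul_smul_comm]

variable (k D) in
/-- The operators of right multiplication on `D`. -/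
noncomputable def rightMulEnd : Submodule k (Module.End k D) :=
  LinearMap.range (LinearMap.mul k D).flip

theorem rightMulEnd_le : rightMulEnd k D ≤ leftLinearEnd k D := by
  rintro _ ⟨d, rfl⟩ x y
  simp [mul_assoc]

omit [IsScalarTower k D D] in
theorem one_mem_leftLinearEnd : (1 : Module.End k D) ∈ leftLinearEnd k D := fun _ _ => rfl

omit [IsScalarTower k D D] in
theorem leftLinearEnd_mul_le : leftLinearEnd k D * leftLinearEnd k D ≤ leftLinearEnd k D :=
  Submodule.mul_le.2 fun f hf g hg x y => by simp [hg x y, hf x (g y)]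

/-- This identity makes the right multiplications a left ideal in the algebra of `D`-linear
endomorphisms. -/
theorem mul_flip_mul {f : Module.End k D} (hf : f ∈ leftLinearEnd k D) (d : D) :
    f * (LinearMap.mul k D).flip d = (LinearMap.mul k D).flip (f d) :=
  LinearMap.ext fun x => hf x d

theorem leftLinearEnd_mul_rightMulEnd_le : leftLinearEnd k D * rightMulEnd k D ≤ rightMulEnd k D :=
  Submodule.mul_le.2 <| by
    rintro f hf _ ⟨d, rfl⟩
    exact ⟨f d, (mul_flip_mul hf d).symm⟩

variable {I : Type w} (e : I → Module.End k D)

/-- The subspaces of `End D` that make up a Morita context between `D` and the algebra spanned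
by the `e i`. -/
noncomputable def corner (i j : Fin 2) : Submodule k (Module.End k D) :=
  (![1, Submodule.span k (Set.range e)] j) * (![rightMulEnd k D, leftLinearEnd k D] i) *
    (![1, Submodule.span k (Set.range e)] i)

variable {e} (he : ∀ i, e i ∈ leftLinearEnd k D)

-- In the product of two corners, everything between the leftmost factor and `![rightMulEnd k D,
-- leftLinearEnd k D] i` is `D`-linear, and that subspace is stable under composition with
-- `D`-linear maps on the left.
include he in
theorem corner_mul_le (i j l : Fin 2) : corner e j l * corner e i j ≤ corner e i l := by
  have hL : ∀ i, ![1, Submodule.span k (Set.range e)] i ≤ leftLinearEnd k D := by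
    intro i
    fin_cases i
    · exact Submodule.one_le.2 one_mem_leftLinearEnd
    · exact Submodule.span_le.2 (Set.range_subset_iff.2 he)
  have hM : ∀ i, ![rightMulEnd k D, leftLinearEnd k D] i ≤ leftLinearEnd k D := by
    intro i
    fin_cases i
    · exact rightMulEnd_le
    · exact le_rfl
  have hLM : ∀ i, leftLinearEnd k D * ![rightMulEnd k D, leftLinearEnd k D] i ≤
      ![rightMulEnd k D, leftLinearEnd k D] i := by
    intro i
    fin_cases i
    · exact leftLinearEnd_mul_rightMulEnd_le
    · exact leftLinearEnd_mul_le
  have hL' := hL j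
  have hM' := hM j
  have hLM' := hLM i
  simp only [corner]
  generalize ![1, Submodule.span k (Set.range e)] i = Li
  generalize ![1, Submodule.span k (Set.range e)] l = Ll
  generalize ![1, Submodule.span k (Set.range e)] j = Lj at *
  generalize ![rightMulEnd k D, leftLinearEnd k D] i = Mi at *
  generalize ![rightMulEnd k D, leftLinearEnd k D] j = Mj at *
  calc Ll * Mj * Lj * (Lj * Mi * Li) = Ll * (Mj * Lj * Lj * Mi) * Li := by simp only [mul_assoc]
    _ ≤ Ll * (leftLinearEnd k D * leftLinearEnd k D * leftLinearEnd k D * Mi) * Li := by gcongr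
    _ ≤ Ll * (leftLinearEnd k D * Mi) * Li := by
      gcongr
      exact (mul_le_mul_left leftLinearEnd_mul_le _).trans leftLinearEnd_mul_le
    _ ≤ Ll * Mi * Li := by gcongr

theorem corner_zero_zero : corner e 0 0 = rightMulEnd k D := by simp [corner]

theorem corner_zero_one :
    corner e 0 1 = Submodule.span k (Set.range e) * rightMulEnd k D := by simp [corner]

theorem corner_one_zero :
    corner e 1 0 = leftLinearEnd k D * Submodule.span k (Set.range e) := by simp [corner]

theorem corner_one_one : corner e 1 1 = Submodule.span k (Set.range e) * leftLinearEnd k D *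
    Submodule.span k (Set.range e) := by simp [corner]

-- `hscalar` and `horth` identify the corner at `1` with `k_I`. `h01` says that the images of the `e
-- i` generate `D`, and `h10` that each `e i` factors through a right multiplication; these give
-- surjectivity of the two mixed multiplication maps. Injectivity then follows from local units.
include he in
open Classical in
theorem isMoritaEquivalent_of_projections
    (hD : ∀ s : Finset D, ∃ e : D, ∀ x ∈ s, e * x = x) (hidem : ∀ i, e i * e i = e i)
    (hne : ∀ i, e i ≠ 0)
    (hscalar : ∀ f ∈ leftLinearEnd k D, ∀ i, ∃ c : k, e i * f * e i = c • e i)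
    (horth : ∀ f ∈ leftLinearEnd k D, ∀ i j, i ≠ j → e j * f * e i = 0)
    (h01 : rightMulEnd k D ≤ leftLinearEnd k D * Submodule.span k (Set.range e) * rightMulEnd k D)
    (h10 : ∀ i, ∃ d : D, ∃ f ∈ leftLinearEnd k D, (LinearMap.mul k D).flip d * f * e i = e i) :
    IsMoritaEquivalent k D (I →₀ k) := by
  have horth' : ∀ i j, i ≠ j → e j * e i = 0 := fun i j hij => by
    simpa using horth 1 one_mem_leftLinearEnd i j hij
  have hmem : ∀ i, e i ∈ Submodule.span k (Set.range e) := fun i => Submodule.subset_span ⟨i, rfl⟩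
  have h11 : corner e 1 1 = Submodule.span k (Set.range e) := by
    rw [corner_one_one]
    apply le_antisymm
    · rw [Submodule.mul_le]
      intro a ha b hb
      induction hb using Submodule.span_induction with
      | zero => simp
      | add b b' _ _ h h' => rw [mul_add]; exact add_mem h h'
      | smul c b _ h => rw [mul_smul_comm]; exact Submodule.smul_mem _ _ h
      | mem b hb =>
      obtain ⟨i, rfl⟩ := hb
      induction ha using Submodule.mul_induction_on' with
      | add a _ a' _ h h' => rw [add_mul]; exact add_mem h h'
      | mem_mul_mem a ha f hf =>
      induction ha using Submodule.span_induction with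
      | zero => simp
      | add b b' _ _ h h' => rw [add_mul, add_mul]; exact add_mem h h'
      | smul c b _ h => rw [smul_mul_assoc, smul_mul_assoc]; exact Submodule.smul_mem _ _ h
      | mem b hb =>
      obtain ⟨j, rfl⟩ := hb
      by_cases hij : i = j
      · subst hij
        obtain ⟨c, hc⟩ := hscalar f hf i
        rw [hc]
        exact Submodule.smul_mem _ _ (hmem i)
      · rw [horth f hf i j hij]
        exact zero_mem _
    · refine Submodule.span_le.2 ?_
      rintro _ ⟨i, rfl⟩
      have := Submodule.mul_mem_mul (Submodule.mul_mem_mul (hmem i) one_mem_leftLinearEnd) (hmem i)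
      rwa [mul_one, hidem] at this
  have hlin : LinearIndependent k e := by
    rw [linearIndependent_iff']
    intro s c hc i hi
    have h1 := congrArg (· * e i) hc
    simp only [Finset.sum_mul, smul_mul_assoc, zero_mul] at h1
    rw [Finset.sum_eq_single_of_mem i hi fun j _ hj => by rw [horth' i j hj.symm, smul_zero],
      hidem] at h1
    exact (smul_eq_zero.1 h1).resolve_right (hne i)
  -- By orthogonality, large finite sums of the `e i` are right units, which provides the local
  -- units at the corner `1`.
  have hsum : ∀ x ∈ leftLinearEnd k D * Submodule.span k (Set.range e), ∃ s : Finset I,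
      ∀ t, s ⊆ t → x * ∑ i ∈ t, e i = x := by
    intro x hx
    induction hx using Submodule.mul_induction_on' with
    | add x _ y _ h h' =>
      obtain ⟨s, hs⟩ := h
      obtain ⟨s', hs'⟩ := h'
      exact ⟨s ∪ s', fun t ht => by rw [add_mul, hs t (Finset.union_subset_left ht),
        hs' t (Finset.union_subset_right ht)]⟩
    | mem_mul_mem f hf a ha =>
    induction ha using Submodule.span_induction with
    | zero => exact ⟨∅, by simp⟩
    | add x y _ _ h h' =>
      obtain ⟨s, hs⟩ := h
      obtain ⟨s', hs'⟩ := h'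
      exact ⟨s ∪ s', fun t ht => by rw [mul_add, add_mul, hs t (Finset.union_subset_left ht),
        hs' t (Finset.union_subset_right ht)]⟩
    | smul c x _ h =>
      obtain ⟨s, hs⟩ := h
      exact ⟨s, fun t ht => by rw [mul_smul_comm, smul_mul_assoc, hs t ht]⟩
    | mem a ha =>
      obtain ⟨i, rfl⟩ := ha
      refine ⟨{i}, fun t ht => ?_⟩
      rw [Finset.mul_sum, Finset.sum_eq_single_of_mem i (ht (by simp)) fun j _ hj => by
        rw [mul_assoc, horth' j i hj, mul_zero], mul_assoc, hidem]
  let C := MoritaContext.ofSubmodules (corner e) (corner_mul_le he)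
  have hsq : Submodule.span k (Set.range e) ≤
      Submodule.span k (Set.range e) * Submodule.span k (Set.range e) := by
    refine Submodule.span_le.2 ?_
    rintro _ ⟨i, rfl⟩
    have := Submodule.mul_mem_mul (hmem i) (hmem i)
    rwa [hidem] at this
  have hLle : Submodule.span k (Set.range e) ≤ leftLinearEnd k D :=
    Submodule.span_le.2 (Set.range_subset_iff.2 he)
  -- Passing to right multiplications reverses products, so left local units of `D` give right local
  -- units here.
  have hu0 : ∀ s : Finset (Module.End k D), (∀ x ∈ s, x ∈ rightMulEnd k D) →
      ∃ a ∈ rightMulEnd k D, ∀ x ∈ s, x * a = x := by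
    intro s hs
    choose! g hg using hs
    obtain ⟨u, hu⟩ := hD (s.image g)
    refine ⟨_, ⟨u, rfl⟩, fun x hx => ?_⟩
    refine LinearMap.ext fun y => ?_
    rw [← hg x hx]
    simp [mul_assoc, hu _ (Finset.mem_image_of_mem g hx)]
  have hu1 : ∀ s : Finset (Module.End k D),
      (∀ x ∈ s, x ∈ leftLinearEnd k D * Submodule.span k (Set.range e)) →
      ∃ a ∈ Submodule.span k (Set.range e), ∀ x ∈ s, x * a = x := by
    intro s hs
    choose! t ht using fun x hx => hsum x (hs x hx)
    exact ⟨∑ i ∈ s.biUnion t, e i, Submodule.sum_mem _ fun i _ => hmem i,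
      fun x hx => ht x hx _ (Finset.subset_biUnion_of_mem t hx)⟩
  have hC : C.IsStrict := by
    apply MoritaContext.isStrict_ofSubmodules
    · refine Fin.forall_fin_two.2 ⟨Fin.forall_fin_two.2 ⟨?_, ?_⟩, Fin.forall_fin_two.2 ⟨?_, ?_⟩⟩
      · rw [corner_zero_zero]
        intro x hx
        obtain ⟨a, ha, h⟩ := hu0 {x} (by simpa using hx)
        rw [← h x (by simp)]
        exact Submodule.mul_mem_mul hx ha
      · rw [corner_zero_zero, corner_one_zero, corner_zero_one]
        exact (h01.trans (mul_le_mul' (mul_le_mul' le_rfl hsq) le_rfl)).trans_eq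
          (by simp only [mul_assoc])
      · rw [h11, corner_one_zero, corner_zero_one]
        refine Submodule.span_le.2 ?_
        rintro _ ⟨i, rfl⟩
        obtain ⟨d, f, hf, h⟩ := h10 i
        have := Submodule.mul_mem_mul (Submodule.mul_mem_mul (hmem i)
          (show (LinearMap.mul k D).flip d ∈ rightMulEnd k D from ⟨d, rfl⟩))
          (Submodule.mul_mem_mul hf (hmem i))
        have h' : e i * (LinearMap.mul k D).flip d * (f * e i) = e i := by
          rw [mul_assoc, ← mul_assoc _ f, h, hidem]
        rwa [h'] at this
      · rwa [h11]
    · refine Fin.forall_fin_two.2 ⟨fun j s hs => ?_, fun j s hs => ?_⟩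
      · rw [corner_zero_zero]
        refine hu0 s fun x hx => ?_
        have hle : ∀ j, corner e 0 j ≤ rightMulEnd k D := by
          refine Fin.forall_fin_two.2 ⟨corner_zero_zero.le, ?_⟩
          rw [corner_zero_one]
          exact (mul_le_mul_left hLle _).trans leftLinearEnd_mul_rightMulEnd_le
        exact hle j (hs x hx)
      · rw [h11]
        refine hu1 s fun x hx => ?_
        have hle : ∀ j, corner e 1 j ≤ leftLinearEnd k D * Submodule.span k (Set.range e) := by
          refine Fin.forall_fin_two.2 ⟨corner_one_zero.le, ?_⟩
          rw [h11]
          exact hsq.trans (mul_le_mul_left hLle _)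
        exact hle j (hs x hx)
  have hinj : Function.Injective (LinearMap.mul k D).flip := by
    refine (injective_iff_map_eq_zero _).2 fun d hd => ?_
    obtain ⟨u, hu⟩ := hD {d}
    rw [← hu d (by simp)]
    exact DFunLike.congr_fun hd u
  let E : D ≃ₗ[k] corner e 0 0 := (LinearEquiv.ofInjective _ hinj).trans
    (LinearEquiv.ofEq _ _ corner_zero_zero.symm)
  let G : (I →₀ k) ≃ₗ[k] corner e 1 1 := hlin.linearCombinationEquiv.trans
    (LinearEquiv.ofEq _ _ h11.symm)
  have hG : ∀ x, (G x : Module.End k D) = Finsupp.linearCombination k e x := fun x => by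
    simp [G]
  refine ⟨C, hC, ⟨E, fun x y => Subtype.ext (LinearMap.ext fun z => (mul_assoc z x y).symm)⟩,
    G, fun x y => Subtype.ext ?_⟩
  change (G (x * y) : Module.End k D) = G y * G x
  simp only [hG]
  induction x using Finsupp.induction_linear with
  | zero => simp
  | add x x' h h' => rw [add_mul, map_add, map_add, h, h', mul_add]
  | single i c =>
  induction y using Finsupp.induction_linear with
  | zero => simp
  | add x x' h h' => rw [mul_add, map_add, map_add, h, h', add_mul]
  | single j d =>
    by_cases hij : i = j
    · subst hij
      rw [← Finsupp.single_mul, Finsupp.linearCombination_single,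
        Finsupp.linearCombination_single, Finsupp.linearCombination_single, smul_mul_smul_comm,
        hidem, mul_comm c]
    · have h0 : Finsupp.single i c * Finsupp.single j d = 0 := by
        ext l
        by_cases hl : i = l
        · subst hl; simp [Finsupp.mul_apply, Ne.symm hij]
        · simp [Finsupp.mul_apply, hl]
      rw [h0]
      simp [horth' i j hij]

end Endomorphisms

/-! ### Algebras whose left regular module is absolutely semisimple -/

section SemisimpleAlgebra

variable {k : Type u} [Field k]

section Projection

variable {V : Type*} [AddCommGroup V] [Module k V] {J : Type*} [DecidableEq J]
  {S : J → Submodule k V} (hS : DirectSum.IsInternal S)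

/-- The projection onto a summand of an internal direct sum. -/
noncomputable def summandProjection (j : J) : V →ₗ[k] V :=
  (S j).subtype ∘ₗ DirectSum.component k J (fun j => S j) j ∘ₗ
    (LinearEquiv.ofBijective (DirectSum.coeLinearMap S) hS).symm.toLinearMap

theorem summandProjection_mem (j : J) (m : V) : summandProjection hS j m ∈ S j :=
  Subtype.property _

theorem summandProjection_of_mem {j : J} {m : V} (hm : m ∈ S j) (j' : J) :
    summandProjection hS j' m = if j = j' then m else 0 := by
  have h : (LinearEquiv.ofBijective (DirectSum.coeLinearMap S) hS).symm m =
      DirectSum.lof k J (fun j => S j) j ⟨m, hm⟩ := by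
    rw [LinearEquiv.symm_apply_eq]
    exact (DirectSum.coeLinearMap_lof S j ⟨m, hm⟩).symm
  change ((DirectSum.component k J (fun j => S j) j'
    ((LinearEquiv.ofBijective (DirectSum.coeLinearMap S) hS).symm m) : S j') : V) = _
  rw [h]
  split_ifs with hj
  · subst hj
    rw [DirectSum.component.lof_self]
  · rw [DirectSum.component.of, dif_neg hj]
    rfl

/-- Applied to left multiplications, this makes the projections onto left ideals `D`-linear. -/
theorem summandProjection_comm {g : V →ₗ[k] V} (hg : ∀ j, ∀ m ∈ S j, g m ∈ S j) (j : J) (m : V) :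
    summandProjection hS j (g m) = g (summandProjection hS j m) := by
  have hm : m ∈ ⨆ j, S j := hS.submodule_iSup_eq_top ▸ trivial
  induction hm using Submodule.iSup_induction' with
  | mem i m hm =>
    rw [summandProjection_of_mem hS hm, summandProjection_of_mem hS (hg i m hm), apply_ite g,
      map_zero]
  | zero => simp
  | add m m' _ _ h h' => simp only [map_add, h, h']

end Projection

variable {D : Type (max u w)} [NonUnitalRing D] [Module k D]
  [IsScalarTower k D D] [SMulCommClass k D D]

/-- One summand from each isomorphism class suffices: homomorphisms between different
representatives vanish, endomorphisms of a representative are scalars, and every summand is a copy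
of a representative. -/
theorem exists_isMoritaEquivalent_of_isAbsolutelySemisimpleAction
    (hD : ∀ s : Finset D, ∃ e : D, ∀ x ∈ s, e * x = x)
    (h : IsAbsolutelySemisimpleAction (LinearMap.mul k D)) :
    ∃ I : Type (max u w), IsMoritaEquivalent k D (I →₀ k) := by
  classical
  obtain ⟨J, S, hSinv, hS, habs⟩ := h
  have hsimple := fun j => (habs j).isSimpleAction
  let p : J → Module.End k D := summandProjection hS
  have hp : ∀ j, p j ∈ leftLinearEnd k D := fun j x y =>
    summandProjection_comm hS (g := LinearMap.mul k D x) (fun j m hm => hSinv j x m hm) j y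
  have hpmem : ∀ j x, p j x ∈ S j := summandProjection_mem hS
  have hpeq : ∀ {j x}, x ∈ S j → ∀ j', p j' x = if j = j' then x else 0 :=
    summandProjection_of_mem hS
  have hpself : ∀ {j x}, x ∈ S j → p j x = x := fun hx => by rw [hpeq hx, if_pos rfl]
  -- the map between summands induced by an endomorphism of `D`
  let c : ∀ (f : Module.End k D) (i j : J), S i →ₗ[k] S j := fun f i j =>
    ((p j ∘ₗ f).codRestrict (S j) fun x => hpmem j _) ∘ₗ (S i).subtype
  have hc : ∀ f i j x, (c f i j x : D) = p j (f x) := fun _ _ _ _ => rfl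
  have hclin : ∀ f ∈ leftLinearEnd k D, ∀ i j (x : D) (m : S i),
      c f i j (restrictAction (LinearMap.mul k D) (S i) (hSinv i) x m) =
        restrictAction (LinearMap.mul k D) (S j) (hSinv j) x (c f i j m) := by
    intro f hf i j x m
    refine Subtype.ext ?_
    change p j (f (x * m)) = x * p j (f m)
    rw [hf, hp]
  -- an isomorphism of summands extends to an endomorphism of `D`
  have hinv : ∀ f ∈ leftLinearEnd k D, ∀ i j, c f i j ≠ 0 → ∃ g ∈ leftLinearEnd k D,
      (∀ m, g m ∈ S i) ∧ (∀ m ∈ S i, g (p j (f m)) = m) ∧ (∀ m ∈ S j, p j (f (g m)) = m) := by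
    intro f hf i j hne
    let E := LinearEquiv.ofBijective _
      ((hsimple i).bijective (hsimple j) (hclin f hf i j) hne)
    have hE : ∀ x, E x = c f i j x := fun _ => rfl
    have hElin : ∀ (x : D) (m : S j),
        E.symm (restrictAction (LinearMap.mul k D) (S j) (hSinv j) x m) =
          restrictAction (LinearMap.mul k D) (S i) (hSinv i) x (E.symm m) := by
      intro x m
      rw [LinearEquiv.symm_apply_eq, hE, hclin f hf, ← hE, E.apply_symm_apply]
    let g : Module.End k D := (S i).subtype ∘ₗ E.symm.toLinearMap ∘ₗ
      (p j).codRestrict (S j) (hpmem j)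
    have hg : ∀ (m : D) (hm : m ∈ S j), g m = E.symm ⟨m, hm⟩ := fun m hm => by
      change ((E.symm ⟨p j m, _⟩ : S i) : D) = _
      simp only [hpself hm]
    refine ⟨g, fun x y => ?_, fun m => Subtype.property _, fun m hm => ?_, fun m hm => ?_⟩
    · have := congrArg Subtype.val (hElin x ⟨p j y, hpmem j y⟩)
      refine Eq.trans ?_ this
      change ((E.symm ⟨p j (x * y), _⟩ : S i) : D) = E.symm ⟨x * p j y, _⟩
      simp only [hp j x y]
    · rw [hg _ (hpmem j _)]
      exact congrArg Subtype.val (E.symm_apply_apply ⟨m, hm⟩)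
    · rw [hg _ hm]
      exact congrArg Subtype.val (E.apply_symm_apply ⟨m, hm⟩)
  -- By Schur's lemma this is isomorphism of summands. For transitivity `p j` is inserted, since
  -- otherwise the component `S i → S l` of `g * f` could pass through other summands.
  let r : Setoid J :=
    { r := fun i j => ∃ f ∈ leftLinearEnd k D, c f i j ≠ 0
      iseqv := by
        have hne : ∀ i, ∃ m ∈ S i, m ≠ 0 := fun i => by
          obtain ⟨x, m, hm⟩ := (hsimple i).1
          exact ⟨m, m.2, fun h0 => hm (by rw [show m = 0 from Subtype.ext h0, map_zero])⟩
        constructor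
        · intro i
          obtain ⟨m, hm, hm0⟩ := hne i
          refine ⟨1, one_mem_leftLinearEnd, fun h0 => hm0 ?_⟩
          have := congrArg Subtype.val (DFunLike.congr_fun h0 ⟨m, hm⟩)
          rwa [hc, Module.End.one_apply, hpself hm] at this
        · rintro i j ⟨f, hf, hfne⟩
          obtain ⟨g, hg, hgm, -, hg2⟩ := hinv f hf i j hfne
          obtain ⟨m, hm, hm0⟩ := hne j
          refine ⟨g, hg, fun h0 => hm0 ?_⟩
          have := congrArg Subtype.val (DFunLike.congr_fun h0 ⟨m, hm⟩)
          rw [hc, hpself (hgm _)] at this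
          rw [← hg2 m hm, this]
          simp
        · rintro i j l ⟨f, hf, hfne⟩ ⟨g, hg, hgne⟩
          have hgb := (hsimple j).bijective (hsimple l) (hclin g hg j l) hgne
          refine ⟨g * p j * f, leftLinearEnd_mul_le (Submodule.mul_mem_mul
            (leftLinearEnd_mul_le (Submodule.mul_mem_mul hg (hp j))) hf), fun h0 => hfne ?_⟩
          refine LinearMap.ext fun m => hgb.1 ?_
          rw [LinearMap.zero_apply, map_zero]
          exact DFunLike.congr_fun h0 m }
  let e : Quotient r → Module.End k D := fun i => p i.out
  have he0 : ∀ i, e i ≠ 0 := fun i h0 => by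
    obtain ⟨x, m, hm⟩ := (hsimple i.out).1
    refine hm ?_
    have : (m : D) = 0 := by rw [← hpself m.2]; exact DFunLike.congr_fun h0 _
    rw [show m = 0 from Subtype.ext this, map_zero]
  refine ⟨Quotient r, isMoritaEquivalent_of_projections (e := e) (fun i => hp _) hD
    (fun i => LinearMap.ext fun x => hpself (hpmem _ x)) he0 (fun f hf i => ?_)
    (fun f hf i j hij => ?_) ?_ fun i => ?_⟩
  · obtain ⟨a, ha⟩ := (habs i.out).exists_eq_smul (c f i.out i.out) (hclin f hf _ _)
    exact ⟨a, LinearMap.ext fun x => congrArg Subtype.val (ha ⟨p i.out x, hpmem _ x⟩)⟩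
  · by_contra hne
    refine hij ?_
    rw [← Quotient.out_eq i, ← Quotient.out_eq j]
    refine Quotient.sound ⟨f, hf, fun h0 => hne ?_⟩
    refine LinearMap.ext fun x => ?_
    have := congrArg Subtype.val (DFunLike.congr_fun h0 ⟨p i.out x, hpmem _ x⟩)
    exact this
  -- For `s ∈ S j`, move `s` to the representative by `f` and back by `g`: right multiplication by
  -- `s` equals `g e` composed with right multiplication by `f s`.
  · rintro _ ⟨d, rfl⟩
    have hd : d ∈ ⨆ j, S j := hS.submodule_iSup_eq_top ▸ trivial
    induction hd using Submodule.iSup_induction' with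
    | zero => rw [map_zero]; exact zero_mem _
    | add m m' _ _ h h' => rw [map_add]; exact add_mem h h'
    | mem j s hs =>
      obtain ⟨f, hf, hne⟩ : r.r j (Quotient.mk r j).out := r.symm (Quotient.mk_out j)
      obtain ⟨g, hg, -, hg1, -⟩ := hinv f hf _ _ hne
      have h1 := Submodule.mul_mem_mul (Submodule.mul_mem_mul hg
        (show e (Quotient.mk r j) ∈ Submodule.span k (Set.range e) from
          Submodule.subset_span ⟨_, rfl⟩))
        (show (LinearMap.mul k D).flip (f s) ∈ rightMulEnd k D from ⟨f s, rfl⟩)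
      have h2 : g * e (Quotient.mk r j) * (LinearMap.mul k D).flip (f s) =
          (LinearMap.mul k D).flip s := by
        rw [mul_assoc, mul_flip_mul (hp _), mul_flip_mul hg]
        exact congrArg _ (hg1 s hs)
      rwa [h2] at h1
  -- Since `D t ≠ 0`, some `S j` has `S j t ≠ 0`, so right multiplication by `t` is an isomorphism
  -- from `S j` onto the representative. Its inverse `g` yields the required factorisation of `e i`.
  · obtain ⟨x, t, hxt⟩ := (hsimple i.out).1
    have hxt' : x * (t : D) ≠ 0 := fun h0 => hxt (Subtype.ext h0)
    obtain ⟨j, s, hs, hst⟩ : ∃ j, ∃ s ∈ S j, s * (t : D) ≠ 0 := by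
      by_contra hcon
      push Not at hcon
      refine hxt' ?_
      have hd : x ∈ ⨆ j, S j := hS.submodule_iSup_eq_top ▸ trivial
      clear hxt hxt'
      induction hd using Submodule.iSup_induction' with
      | zero => exact zero_mul _
      | add m m' _ _ h h' => rw [add_mul, h, h', add_zero]
      | mem j s hs => exact hcon j s hs
    have hR : (LinearMap.mul k D).flip (t : D) ∈ leftLinearEnd k D := rightMulEnd_le ⟨t, rfl⟩
    have htS : ∀ y : D, y * (t : D) ∈ S i.out := fun y => hSinv _ y _ t.2
    obtain ⟨g, hg, -, -, hg2⟩ := hinv _ hR j i.out fun h0 => hst <| by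
      have := congrArg Subtype.val (DFunLike.congr_fun h0 ⟨s, hs⟩)
      rwa [hc, hpself (by exact htS s)] at this
    refine ⟨t, g, hg, LinearMap.ext fun y => ?_⟩
    have := hg2 (p i.out y) (hpmem _ y)
    rwa [hpself (by exact htS _)] at this

end SemisimpleAlgebra

end HopfCoaction

/-! ### The equivalence of the three conditions -/

theorem mainTheorem5 {k : Type u} [Field k] {H : Type v} [Ring H] [HopfAlgebra k H]
    (F : HopfCoaction.InvariantFunctionals k H)
    {A : Type w} [NonUnitalRing A] [Module k A] [IsScalarTower k A A] [SMulCommClass k A A]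
    (α : HopfCoaction.ComoduleAlgebra k H A) (hα : α.HasCoinvariantLocalUnits) :
    List.TFAE
      [α.IsAbsolutelySemisimple,
       HopfCoaction.IsAbsolutelySemisimpleAlgebra k (HopfCoaction.SmashProduct α F),
       ∃ I : Type (max u v w),
         HopfCoaction.IsMoritaEquivalent k (HopfCoaction.SmashProduct α F) (I →₀ k)] := by
  have hD := HopfCoaction.SmashProduct.exists_left_unit (F := F) hα
  tfae_have 1 → 3 := fun h =>
    HopfCoaction.exists_isMoritaEquivalent_of_isAbsolutelySemisimpleAction.{u, max v w} hD
      (HopfCoaction.SmashProduct.isAbsolutelySemisimpleAction_mul hα h)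
  tfae_have 3 → 2 := fun ⟨_, h⟩ =>
    HopfCoaction.isAbsolutelySemisimpleAlgebra_of_isMoritaEquivalent hD h
  tfae_have 2 → 1 := HopfCoaction.ComoduleAlgebra.isAbsolutelySemisimple_of_smashProduct hα
  tfae_finish
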